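/- **Definitions.** A metric space $X$ has *asymptotic dimension at most $n$* if for every uniformly bounded open cover $\mathcal V$ of $X$ there is a uniformly bounded open cover $\mathcal U$ of $X$ such that every point lies in at most $n+1$ members of $\mathcal U$ and every member of $\mathcal V$ is contained in a member of $\mathcal U$; $\mathrm{asdim}(X)\in\mathbb N\cup\{\infty\}$ is the least such $n$. For a graph, $\mathrm{asdim}$ refers to its vertex set with the graph distance (vertices in different components having distance $\infty$), and for a set of vertices to that distance restricted to the set. Let $G_1,G_2$ be graphs, $I_1,I_2$ disjoint sets, $(S^i_k)_{k\in I_i}$ a family of subsets of $V(G_i)$ for $i=1,2$, all of the same cardinality, and for $k\in I_1$, $\ell\in I_2$ let $\varphi_{k\ell}\colon S^1_k\to S^2_\ell$ be a bijection, with $\varphi_{\ell k}:=\varphi_{k\ell}^{-1}$ (the *bonding maps*). Let $T$ be a tree with bipartition $\{V_1,V_2\}$ of its vertex set, each edge $uv$ carrying a label $f(\overrightarrow{uv})$ for each of its two orientations, such that for every $v\in V_i$ the edges starting at $v$ have labels in $I_i$ and every $k\in I_i$ occurs precisely once among them. Take the disjoint union of copies $G_v$ of $G_i$, one for each $v\in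 V_i$, $i=1,2$, with copies $S^v_k$ of the sets $S^i_k$. For every edge $uv$ of $T$, with $k=f(\overrightarrow{uv})$ and $\ell=f(\overrightarrow{vu})$, join each $x\in S^u_k$ to $\varphi_{k\ell}(x)\in S^v_\ell$ by a new edge. The graph $G_1\ast G_2$ obtained by contracting all new edges (disregarding loops and parallel edges) is the *tree amalgamation*; let $\pi$ be the contraction map on vertices. The *adhesion sets* are the sets $S^i_k$ (in $G_i$) and the images $\pi(S^v_k)$ (in $G_1\ast G_2$). The tree amalgamation has *finite identification* if there is an $N\in\mathbb N$ such that for every vertex $x$ of $G_1\ast G_2$ at most $N$ of the copies $G_v$ meet $\pi^{-1}(x)$. Let groups $\Gamma_1,\Gamma_2$ act on $G_1,G_2$ by automorphisms, and let $R\subseteq I_1\times I_2$, read as a symmetric relation between $I_1$ and $I_2$. We say that *the bonding maps in $R$ are respected and consistent* if for $\{i,j\}=\{1,2\}$, in both orders: * for every $\gamma\in\Gamma_i$ there is a permutation $\sigma$ of $I_i$ such that for every $k\in I_i$ there are $\ell\in I_j$, with $k$ and $\sigma(k)$ both related to $\ell$ by $R$, and $\tau$ in the setwise stabiliser of $S^j_\ell$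 in $\Gamma_j$ such that $\gamma S^i_k\subseteq S^i_{\sigma(k)}$ and $\varphi_{k\ell}=\tau\circ\varphi_{\sigma(k)\ell}\circ\gamma|_{S^i_k}$; * for all $k\in I_i$ and $\ell,\ell'\in I_j$, both related to $k$ by $R$, there is $\gamma\in\Gamma_j$ with $\varphi_{k\ell}=\gamma\circ\varphi_{k\ell'}$. The tree amalgamation *respects the actions of $\Gamma_1$ and $\Gamma_2$* if one of the following holds. * (Type 1) The bonding maps in $R=I_1\times I_2$ are respected and consistent. * (Type 2) $G_1=G_2$ and $\Gamma_1=\Gamma_2$ with the same action, $I_1$ and $I_2$ are identified with one set $I$ by a bijection such that $S^1_k=S^2_k$ for all $k\in I$, and there is $J\subseteq I$ such that precisely one of the two labels of each edge of $T$ lies in $J$ and such that the bonding maps in $R$ are respected and consistent, where $R$ is the set of those pairs in $I_1\times I_2$ of which precisely one entry lies in $J$. **Theorem.** Let $G_1,G_2$ be locally finite connected graphs and let $\Gamma_1,\Gamma_2$ be groups acting on $G_1,G_2$, respectively, by automorphisms with finitely many vertex orbits. Let $G=G_1\ast G_2$ be a tree amalgamation of finite identification that respects the actions of $\Gamma_1$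 and $\Gamma_2$. Then, for every adhesion set $C$ of $G_1\ast G_2$, $$\mathrm{asdim}(G)\le\max\{\mathrm{asdim}(G_1),\ \mathrm{asdim}(G_2),\ \mathrm{asdim}(C)+1\}.$$ -/

import Mathlib

open scoped Pointwise

/-! ### Asymptotic dimension -/

/-- A family of subsets is uniformly bounded: the supremum of the diameters is finite. -/
def UniformlyBounded {X : Type*} [PseudoEMetricSpace X] (𝒱 : Set (Set X)) : Prop :=
  (⨆ A ∈ 𝒱, Metric.ediam A) < ⊤

/-- An open cover of `X`. -/
def OpenCover {X : Type*} [PseudoEMetricSpace X] (𝒱 : Set (Set X)) : Prop :=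
  (∀ A ∈ 𝒱, IsOpen A) ∧ ⋃₀ 𝒱 = Set.univ

/-- The multiplicity of the family is at most `m`: every point lies in at most `m` members. -/
def MultiplicityLE {X : Type*} (𝒰 : Set (Set X)) (m : ℕ) : Prop :=
  ∀ x : X, {A | A ∈ 𝒰 ∧ x ∈ A}.encard ≤ m

/-- `𝒰` refines `𝒱`. -/
def Refines {X : Type*} (𝒰 𝒱 : Set (Set X)) : Prop :=
  ∀ A ∈ 𝒰, ∃ B ∈ 𝒱, A ⊆ B

/-- `X` has asymptotic dimension at most `n`. -/
def AsdimLE (X : Type*) [PseudoEMetricSpace X] (n : ℕ) : Prop :=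
  ∀ 𝒱 : Set (Set X), OpenCover 𝒱 → UniformlyBounded 𝒱 →
    ∃ 𝒰 : Set (Set X), OpenCover 𝒰 ∧ UniformlyBounded 𝒰 ∧
      MultiplicityLE 𝒰 (n + 1) ∧ Refines 𝒱 𝒰

/-- The asymptotic dimension; it is `⊤` if no `n` bounds it. -/
noncomputable def asdim (X : Type*) [PseudoEMetricSpace X] : ℕ∞ :=
  ⨅ (n : ℕ) (_ : AsdimLE X n), (n : ℕ∞)

/-- The graph distance on the vertex set (`⊤` between different components). -/
@[reducible]
noncomputable def graphMetric {V : Type*} (G : SimpleGraph V) : PseudoEMetricSpace V where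
  edist x y := (G.edist x y : ENNReal)
  edist_self x := by simp
  edist_comm x y := by simp only [SimpleGraph.edist_comm]
  edist_triangle x y z := by
    rw [← ENat.toENNReal_add]
    exact ENat.toENNReal_le.2 SimpleGraph.edist_triangle

/-- The asymptotic dimension of a graph, i.e. of its vertex set with the graph distance. -/
noncomputable def graphAsdim {V : Type*} (G : SimpleGraph V) : ℕ∞ :=
  letI := graphMetric G
  asdim V

/-- The asymptotic dimension of a set `C` of vertices, with the distance of `G` restricted to `C`. -/
noncomputable def setAsdim {V : Type*} (G : SimpleGraph V) (C : Set V) : ℕ∞ :=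
  letI := graphMetric G
  asdim C

/-! ### Group actions on graphs -/

/-- The group `Γ` acts on the graph `G` by automorphisms. -/
def ActsOnGraph (Γ : Type*) {V : Type*} [Group Γ] [MulAction Γ V] (G : SimpleGraph V) : Prop :=
  ∀ (γ : Γ) (x y : V), G.Adj (γ • x) (γ • y) ↔ G.Adj x y

/-- The group `Γ` acts on the graph `G` by automorphisms, with finitely many vertex orbits. -/
def ActsQuasiTransitively (Γ : Type*) {V : Type*} [Group Γ] [MulAction Γ V]
    (G : SimpleGraph V) : Prop :=
  ActsOnGraph Γ G ∧ Finite (MulAction.orbitRel.Quotient Γ V)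

/-! ### Tree amalgamations -/

/-- The data of a tree amalgamation of a graph on `V₁` and a graph on `V₂`: the families of
adhesion sets, the bonding maps, and the labelled connecting tree, whose canonical bipartition
is into `W₁` and `W₂`. -/
structure AmalgamData (V₁ V₂ I₁ I₂ W₁ W₂ : Type*) where
  /-- the adhesion sets in the first graph -/
  S₁ : I₁ → Set V₁
  /-- the adhesion sets in the second graph -/
  S₂ : I₂ → Set V₂
  /-- the bonding maps -/
  φ : ∀ (k : I₁) (l : I₂), S₁ k ≃ S₂ l
  /-- the connecting tree -/
  tree : SimpleGraph (W₁ ⊕ W₂)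
  isTree : tree.IsTree
  bipartite : tree.IsBipartiteWith (Set.range Sum.inl) (Set.range Sum.inr)
  /-- `lab₁ u w` is the label of the directed tree edge from `u` to `w`
  (only used if `u` and `w` are adjacent) -/
  lab₁ : W₁ → W₂ → I₁
  /-- `lab₂ w u` is the label of the directed tree edge from `w` to `u`
  (only used if `u` and `w` are adjacent) -/
  lab₂ : W₂ → W₁ → I₂
  /-- every label in `I₁` occurs precisely once at the edges starting at `u` -/
  lab₁_unique : ∀ (u : W₁) (k : I₁), ∃! w : W₂, tree.Adj (Sum.inl u) (Sum.inr w) ∧ lab₁ u w = k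
  /-- every label in `I₂` occurs precisely once at the edges starting at `w` -/
  lab₂_unique : ∀ (w : W₂) (l : I₂), ∃! u : W₁, tree.Adj (Sum.inl u) (Sum.inr w) ∧ lab₂ w u = l

namespace AmalgamData

variable {V₁ V₂ I₁ I₂ W₁ W₂ : Type*}

/-- The disjoint union of copies of `G₁`, one for each node in `W₁`, and copies of `G₂`, one for
each node in `W₂`. -/
def copies (_D : AmalgamData V₁ V₂ I₁ I₂ W₁ W₂) (G₁ : SimpleGraph V₁) (G₂ : SimpleGraph V₂) :
    SimpleGraph ((W₁ × V₁) ⊕ (W₂ × V₂)) where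
  Adj
    | .inl p, .inl q => p.1 = q.1 ∧ G₁.Adj p.2 q.2
    | .inr p, .inr q => p.1 = q.1 ∧ G₂.Adj p.2 q.2
    | _, _ => False
  symm := ⟨by
    rintro (p | p) (q | q) h
    · exact ⟨h.1.symm, h.2.symm⟩
    · exact h
    · exact h
    · exact ⟨h.1.symm, h.2.symm⟩⟩
  loopless := ⟨by
    rintro (p | p) h
    · exact G₁.irrefl h.2
    · exact G₂.irrefl h.2⟩

/-- The vertex `x` in the copy at `u` is joined by a new edge to the vertex `y` in the copy
at `w`. -/
def Bond (D : AmalgamData V₁ V₂ I₁ I₂ W₁ W₂) (u : W₁) (x : V₁) (w : W₂) (y : V₂) : Prop :=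
  D.tree.Adj (Sum.inl u) (Sum.inr w) ∧
    ∃ hx : x ∈ D.S₁ (D.lab₁ u w), (D.φ (D.lab₁ u w) (D.lab₂ w u) ⟨x, hx⟩ : V₂) = y

/-- The graph that consists of the new edges between the copies. -/
def bonds (D : AmalgamData V₁ V₂ I₁ I₂ W₁ W₂) : SimpleGraph ((W₁ × V₁) ⊕ (W₂ × V₂)) where
  Adj
    | .inl p, .inr q => D.Bond p.1 p.2 q.1 q.2
    | .inr q, .inl p => D.Bond p.1 p.2 q.1 q.2
    | _, _ => False
  symm := ⟨by rintro (p | p) (q | q) h <;> exact h⟩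
  loopless := ⟨by rintro (p | p) h <;> exact h⟩

/-- The graph `G₁ + G₂`. -/
def plus (D : AmalgamData V₁ V₂ I₁ I₂ W₁ W₂) (G₁ : SimpleGraph V₁) (G₂ : SimpleGraph V₂) :
    SimpleGraph ((W₁ × V₁) ⊕ (W₂ × V₂)) :=
  D.copies G₁ G₂ ⊔ D.bonds

/-- The vertices of the tree amalgamation, obtained by contracting all the new edges. -/
abbrev Vertex (D : AmalgamData V₁ V₂ I₁ I₂ W₁ W₂) : Type _ :=
  D.bonds.ConnectedComponent

/-- The canonical map from the vertices of `G₁ + G₂` to those of the tree amalgamation. -/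
def proj (D : AmalgamData V₁ V₂ I₁ I₂ W₁ W₂) (x : (W₁ × V₁) ⊕ (W₂ × V₂)) : D.Vertex :=
  D.bonds.connectedComponentMk x

/-- The tree amalgamation: the graph obtained from `G₁ + G₂` by contracting all the new edges
(as a simple graph, so without loops and parallel edges). -/
def amalgam (D : AmalgamData V₁ V₂ I₁ I₂ W₁ W₂) (G₁ : SimpleGraph V₁) (G₂ : SimpleGraph V₂) :
    SimpleGraph D.Vertex where
  Adj a b := a ≠ b ∧ ∃ x y, D.proj x = a ∧ D.proj y = b ∧ (D.plus G₁ G₂).Adj x y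
  symm := ⟨fun _ _ ⟨hne, x, y, hx, hy, h⟩ => ⟨hne.symm, y, x, hy, hx, h.symm⟩⟩
  loopless := ⟨fun _ h => h.1 rfl⟩

/-- The node of the connecting tree whose copy contains the given vertex of `G₁ + G₂`. -/
def node : (W₁ × V₁) ⊕ (W₂ × V₂) → W₁ ⊕ W₂ :=
  Sum.map Prod.fst Prod.fst

/-- The nodes whose copies contain a vertex that is mapped to `a`; their number is the
identification size of `a`. -/
def nodesOf (D : AmalgamData V₁ V₂ I₁ I₂ W₁ W₂) (a : D.Vertex) : Set (W₁ ⊕ W₂) :=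
  {t | ∃ x, node x = t ∧ D.proj x = a}

/-- The identification sizes are bounded. -/
def FiniteIdentification (D : AmalgamData V₁ V₂ I₁ I₂ W₁ W₂) : Prop :=
  ∃ N : ℕ, ∀ a : D.Vertex, (D.nodesOf a).encard ≤ N

/-- The image in the tree amalgamation of the `k`-th adhesion set of the copy of the first graph
at `u`. -/
def image₁ (D : AmalgamData V₁ V₂ I₁ I₂ W₁ W₂) (u : W₁) (k : I₁) : Set D.Vertex :=
  (fun x => D.proj (Sum.inl (u, x))) '' D.S₁ k

/-- The image in the tree amalgamation of the `l`-th adhesion set of the copy of the second graph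
at `w`. -/
def image₂ (D : AmalgamData V₁ V₂ I₁ I₂ W₁ W₂) (w : W₂) (l : I₂) : Set D.Vertex :=
  (fun y => D.proj (Sum.inr (w, y))) '' D.S₂ l

end AmalgamData

/-! ### Tree amalgamations that respect group actions

In the following two definitions `V, I, S, Γ` belong to one of the two sides and `V', I', S', Γ'`
to the other one. The relation `R` says which pairs of labels are taken into account. -/

/-- `γ` is respected: there is a permutation `σ` of `I` such that for every `k` there are `l` and
an element `τ` of the setwise stabiliser of `S' l` with `φ k l = τ ∘ φ (σ k) l ∘ γ` on `S k`. -/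
def RespectsElement {V V' I I' Γ : Type*} (Γ' : Type*) [Group Γ] [MulAction Γ V] [Group Γ']
    [MulAction Γ' V'] {S : I → Set V} {S' : I' → Set V'} (φ : ∀ k l, S k ≃ S' l)
    (R : I → I' → Prop) (γ : Γ) : Prop :=
  ∃ σ : Equiv.Perm I, ∀ k : I, ∃ l : I', R k l ∧ R (σ k) l ∧
    ∃ τ ∈ MulAction.stabilizer Γ' (S' l), ∀ x : S k, ∃ hx : γ • (x : V) ∈ S (σ k),
      (φ k l x : V') = τ • (φ (σ k) l ⟨γ • (x : V), hx⟩ : V')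

/-- The bonding maps from any `k` to any `l` and `l'` are consistent:
`φ k l = γ ∘ φ k l'` for some `γ` in the group `Γ'`. -/
def ConsistentBonds {V V' I I' : Type*} (Γ' : Type*) [Group Γ'] [MulAction Γ' V']
    {S : I → Set V} {S' : I' → Set V'} (φ : ∀ k l, S k ≃ S' l) (R : I → I' → Prop) : Prop :=
  ∀ (k : I) (l l' : I'), R k l → R k l' →
    ∃ γ : Γ', ∀ x : S k, (φ k l x : V') = γ • (φ k l' x : V')

namespace AmalgamData

variable {V₁ V₂ I₁ I₂ W₁ W₂ : Type*}

/-- With respect to the bonding maps between labels related by `R`, all elements of both groups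
are respected, and the bonding maps are consistent in both directions. -/
def RespectsAndConsistent (D : AmalgamData V₁ V₂ I₁ I₂ W₁ W₂) (Γ₁ Γ₂ : Type*)
    [Group Γ₁] [MulAction Γ₁ V₁] [Group Γ₂] [MulAction Γ₂ V₂] (R : I₁ → I₂ → Prop) : Prop :=
  (∀ γ : Γ₁, RespectsElement Γ₂ D.φ R γ) ∧
  (∀ γ : Γ₂, RespectsElement Γ₁ (fun l k => (D.φ k l).symm) (fun l k => R k l) γ) ∧
  ConsistentBonds Γ₂ D.φ R ∧
  ConsistentBonds Γ₁ (fun l k => (D.φ k l).symm) (fun l k => R k l)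

/-- Type 1 respecting the actions: all pairs of labels are taken into account. -/
def IsType1 (D : AmalgamData V₁ V₂ I₁ I₂ W₁ W₂) (Γ₁ Γ₂ : Type*)
    [Group Γ₁] [MulAction Γ₁ V₁] [Group Γ₂] [MulAction Γ₂ V₂] : Prop :=
  D.RespectsAndConsistent Γ₁ Γ₂ (fun _ _ => True)

/-- Type 2 respecting the actions. The two graphs, with the group actions and the families of
adhesion sets, are identified through `α`, `β` and `ι`. There is a set `J` of labels such that
precisely one of the two labels of each tree edge lies in `J`. Hence only the bonding maps between
`J` and its complement occur in the tree amalgamation, and only these are taken into account. -/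
def IsType2 (D : AmalgamData V₁ V₂ I₁ I₂ W₁ W₂) (G₁ : SimpleGraph V₁) (G₂ : SimpleGraph V₂)
    (Γ₁ Γ₂ : Type*) [Group Γ₁] [MulAction Γ₁ V₁] [Group Γ₂] [MulAction Γ₂ V₂] : Prop :=
  ∃ (α : G₁ ≃g G₂) (β : Γ₁ ≃* Γ₂) (ι : I₁ ≃ I₂) (J : Set I₁),
    (∀ (γ : Γ₁) (x : V₁), α (γ • x) = β γ • α x) ∧
    (∀ k : I₁, D.S₂ (ι k) = α '' D.S₁ k) ∧
    (∀ (u : W₁) (w : W₂), D.tree.Adj (Sum.inl u) (Sum.inr w) →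
      (D.lab₁ u w ∈ J ↔ D.lab₂ w u ∉ ι '' J)) ∧
    D.RespectsAndConsistent Γ₁ Γ₂ (fun k l => k ∈ J ↔ l ∉ ι '' J)

/-- The tree amalgamation respects the actions of `Γ₁` on `G₁` and of `Γ₂` on `G₂`. -/
def RespectsActions (D : AmalgamData V₁ V₂ I₁ I₂ W₁ W₂) (G₁ : SimpleGraph V₁)
    (G₂ : SimpleGraph V₂) (Γ₁ Γ₂ : Type*) [Group Γ₁] [MulAction Γ₁ V₁] [Group Γ₂]
    [MulAction Γ₂ V₂] : Prop :=
  D.IsType1 Γ₁ Γ₂ ∨ D.IsType2 G₁ G₂ Γ₁ Γ₂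

end AmalgamData

/-!
A graph has asymptotic dimension less than `m` if and only if at every scale its vertices can be
coloured with `m` colours such that monochromatic chains are bounded. Let `n` be the maximum on the
right-hand side and root the tree. There are only finitely many vertex orbits and the bonding maps
are respected and consistent, so these maps are coarse equivalences with common control functions.
Hence the copies of `G₁` and `G₂` are uniformly coarsely embedded in the amalgamation. It follows,
again uniformly, that unions of copies over boundedly many levels below a node have asymptotic
dimension at most `n` and that adhesion sets have asymptotic dimension at most `n - 1`. Cut the
amalgamation at depths that are multiples of a large constant. The boundaries of the resulting
pieces are neighbourhoods of adhesion sets that are far apart, so `n` colours suffice for all of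
them at once. A cover given by `n + 1` colours inside the pieces is glued with the cover given by
these `n` colours: the colour `j` of the boundary reaches up to a height that increases with `j`, so
that, at every height, at most one boundary colour overlaps with the sets that replace it.
-/

/-! ### Bounded distances in graphs -/

/-- The vertices `x` and `y` of `G` are at distance at most `r`. -/
def DistLE {V : Type*} (G : SimpleGraph V) (r : ℕ) (x y : V) : Prop := G.edist x y ≤ r

namespace DistLE

variable {V V' : Type*} {G : SimpleGraph V} {G' : SimpleGraph V'} {x y z : V} {r s t : ℕ}

lemma refl (G : SimpleGraph V) (r : ℕ) (x : V) : DistLE G r x x := by simp [DistLE]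

lemma symm (h : DistLE G r x y) : DistLE G r y x := by
  rwa [DistLE, SimpleGraph.edist_comm]

lemma mono (h : DistLE G r x y) (hrs : r ≤ s) : DistLE G s x y :=
  le_trans h (by exact_mod_cast hrs)

lemma trans (hxy : DistLE G r x y) (hyz : DistLE G s y z) (h : r + s ≤ t) : DistLE G t x z := by
  refine le_trans SimpleGraph.edist_triangle ((add_le_add hxy hyz).trans ?_)
  exact_mod_cast h

lemma of_walk (w : G.Walk x y) (h : w.length ≤ r) : DistLE G r x y :=
  (SimpleGraph.edist_le w).trans (by exact_mod_cast h)

lemma exists_walk (h : DistLE G r x y) : ∃ w : G.Walk x y, w.length ≤ r := by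
  obtain ⟨w, hw⟩ :=
    SimpleGraph.exists_walk_of_edist_ne_top (ne_top_of_le_ne_top (ENat.natCast_ne_top r) h)
  rw [DistLE, ← hw] at h
  exact ⟨w, by exact_mod_cast h⟩

lemma of_adj (h : G.Adj x y) : DistLE G 1 x y := of_walk h.toWalk (by simp)

lemma zero_iff : DistLE G 0 x y ↔ x = y := by simp [DistLE]

lemma exists_of_connected (h : G.Connected) (x y : V) : ∃ r, DistLE G r x y := by
  obtain ⟨w⟩ := h.preconnected x y
  exact ⟨w.length, of_walk w le_rfl⟩

lemma mem_and_map_of_closed {S : Set V} (f : V → V')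
    (hS : ∀ a ∈ S, ∀ b, G.Adj a b → b ∈ S ∧ DistLE G' 1 (f a) (f b)) (hx : x ∈ S)
    (h : DistLE G r x y) : y ∈ S ∧ DistLE G' r (f x) (f y) := by
  obtain ⟨w, hw⟩ := h.exists_walk
  induction w generalizing r with
  | nil => exact ⟨hx, refl G' r _⟩
  | @cons u v _ huv w ih =>
    obtain ⟨hv, hfuv⟩ := hS u hx v huv
    obtain ⟨hy, hfvy⟩ := ih hv (of_walk w le_rfl) le_rfl
    exact ⟨hy, hfuv.trans hfvy (by rw [SimpleGraph.Walk.length_cons] at hw; omega)⟩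

lemma map (f : V → V') (hf : ∀ a b, G.Adj a b → DistLE G' 1 (f a) (f b)) (h : DistLE G r x y) :
    DistLE G' r (f x) (f y) :=
  (h.mem_and_map_of_closed f (fun a _ b hab => ⟨Set.mem_univ b, hf a b hab⟩) (Set.mem_univ x)).2

lemma le_add_mul {f : V → ℕ} {K : ℕ} (hf : ∀ a b, G.Adj a b → f a ≤ f b + K)
    (h : DistLE G r x y) : f x ≤ f y + K * r := by
  obtain ⟨w, hw⟩ := h.exists_walk
  refine le_trans ?_ (Nat.add_le_add_left (Nat.mul_le_mul_left K hw) _)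
  clear h hw
  induction w with
  | nil => simp
  | cons huv w ih =>
    have := hf _ _ huv
    simp only [SimpleGraph.Walk.length_cons, mul_add]
    omega

lemma finite_setOf (hfin : ∀ x, (G.neighborSet x).Finite) (r : ℕ) (x : V) :
    {y | DistLE G r x y}.Finite := by
  induction r with
  | zero => simp [zero_iff]
  | succ r ih =>
    refine (ih.union (ih.biUnion fun y _ => hfin y)).subset fun z hz => ?_
    obtain ⟨w, hw⟩ := (symm hz).exists_walk
    cases w with
    | nil => exact Or.inl (refl G r _)
    | @cons _ v _ hzv w =>
      have hxv : DistLE G r x v := (of_walk w (by simpa using hw)).symm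
      exact Or.inr (Set.mem_biUnion hxv hzv.symm)

end DistLE

lemma exists_exit_of_walk {V : Type*} {G : SimpleGraph V} (S : Set V) {x y : V} (w : G.Walk x y)
    (hx : x ∈ S) (hy : y ∉ S) : ∃ a b, a ∈ S ∧ b ∉ S ∧ G.Adj a b ∧
      ∃ (w₁ : G.Walk x a) (w₂ : G.Walk b y), w₁.length + 1 + w₂.length = w.length := by
  induction w with
  | nil => exact absurd hx hy
  | @cons u v _ huv w ih =>
    by_cases hv : v ∈ S
    · obtain ⟨a, b, ha, hb, hab, w₁, w₂, hlen⟩ := ih hv hy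
      exact ⟨a, b, ha, hb, hab, .cons huv w₁, w₂, by
        simp only [SimpleGraph.Walk.length_cons]; omega⟩
    · exact ⟨u, v, hx, hv, huv, .nil, w, by
        simp only [SimpleGraph.Walk.length_cons, SimpleGraph.Walk.length_nil]; omega⟩

/-! ### Colourings with bounded monochromatic chains -/

/-- One step of a monochromatic `r`-chain in `A`. -/
def ChainStep {V κ : Type*} (G : SimpleGraph V) (A : Set V) (c : V → κ) (r : ℕ) (a b : V) : Prop :=
  a ∈ A ∧ b ∈ A ∧ c a = c b ∧ DistLE G r a b

/-- Two vertices are joined by a monochromatic `r`-chain in `A`. Outside `A` only the trivial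
chains exist. -/
abbrev Chain {V κ : Type*} (G : SimpleGraph V) (A : Set V) (c : V → κ) (r : ℕ) : V → V → Prop :=
  Relation.ReflTransGen (ChainStep G A c r)

/-- The ends of every monochromatic `r`-chain in `A` are at distance at most `D`. -/
def ChainsBounded {V κ : Type*} (G : SimpleGraph V) (A : Set V) (c : V → κ) (r D : ℕ) : Prop :=
  ∀ x y, Chain G A c r x y → DistLE G D x y

/-- The set `A` can be coloured with `m` colours such that the ends of every monochromatic
`r`-chain are at distance at most `D`. -/
def HasColoring {V : Type*} (G : SimpleGraph V) (A : Set V) (m r D : ℕ) : Prop :=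
  ∃ c : V → ℕ, (∀ x ∈ A, c x < m) ∧ ChainsBounded G A c r D

/-- The set `A` of vertices has asymptotic dimension less than `m`: at every scale it can be
coloured with `m` colours such that monochromatic chains are bounded. -/
def AsdimLT {V : Type*} (G : SimpleGraph V) (A : Set V) (m : ℕ) : Prop :=
  ∀ r, ∃ D, HasColoring G A m r D

/-- The members of a family of vertex sets have asymptotic dimension less than `m` uniformly. -/
def FamilyAsdimLT {V ι : Type*} (G : SimpleGraph V) (A : ι → Set V) (m : ℕ) : Prop :=
  ∀ r, ∃ D, ∀ i, HasColoring G (A i) m r D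

/-- The set of vertices at distance at most `s` from `A`. -/
def neighborhood {V : Type*} (G : SimpleGraph V) (s : ℕ) (A : Set V) : Set V :=
  {x | ∃ a ∈ A, DistLE G s x a}

section Colorings

variable {V V' κ : Type*} {G : SimpleGraph V} {G' : SimpleGraph V'} {A B : Set V}
  {c c' : V → κ} {m m' r r' s d D D' : ℕ} {x y : V}

lemma ChainStep.symm (h : ChainStep G A c r x y) : ChainStep G A c r y x :=
  ⟨h.2.1, h.1, h.2.2.1.symm, h.2.2.2.symm⟩

lemma ChainStep.congr (hc : Set.EqOn c c' A) (h : ChainStep G A c r x y) :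
    ChainStep G A c' r x y :=
  ⟨h.1, h.2.1, by rw [← hc h.1, ← hc h.2.1]; exact h.2.2.1, h.2.2.2⟩

lemma Chain.symm (h : Chain G A c r x y) : Chain G A c r y x := by
  induction h with
  | refl => exact .refl
  | tail _ hbc ih => exact ih.head hbc.symm

lemma Chain.mem_iff (h : Chain G A c r x y) : x ∈ A ↔ y ∈ A := by
  induction h with
  | refl => rfl
  | tail _ hbc ih => exact ih.trans ⟨fun _ => hbc.2.1, fun _ => hbc.1⟩

lemma Chain.color_eq (h : Chain G A c r x y) : c x = c y := by
  induction h with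
  | refl => rfl
  | tail _ hbc ih => exact ih.trans hbc.2.2.1

lemma Chain.eq_of_notMem (h : Chain G A c r x y) (hx : x ∉ A) : x = y := by
  rcases h.cases_head with hxy | ⟨z, hxz, -⟩
  · exact hxy
  · exact absurd hxz.1 hx

lemma ChainsBounded.congr (hc : Set.EqOn c c' A) (h : ChainsBounded G A c' r D) :
    ChainsBounded G A c r D :=
  fun x y hxy => h x y (Relation.ReflTransGen.mono (fun _ _ => ChainStep.congr hc) _ _ hxy)

lemma ChainsBounded.mono (h : ChainsBounded G B c r D) (hA : A ⊆ B) (hr : r' ≤ r) (hD : D ≤ D') :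
    ChainsBounded G A c r' D' := by
  refine fun x y hxy => (h x y ?_).mono hD
  exact Relation.ReflTransGen.mono
    (fun a b ⟨ha, hb, hab, hd⟩ => ⟨hA ha, hA hb, hab, hd.mono hr⟩) _ _ hxy

lemma ChainsBounded.of_fibers {ι : Type*} {label : V → ι} {c : ι → V → κ}
    (h : ∀ i, ChainsBounded G (A ∩ label ⁻¹' {i}) (c i) r D) :
    ChainsBounded G A (fun x => (label x, c (label x) x)) r D := by
  refine fun x y hxy => h (label x) x y ?_
  induction hxy using Relation.ReflTransGen.head_induction_on with
  | refl => exact .refl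
  | @head u v huv _ ih =>
    obtain ⟨hu, hv, hcuv, hduv⟩ := huv
    obtain ⟨hl, hcuv⟩ := Prod.ext_iff.1 hcuv
    simp only at hl hcuv
    rw [← hl] at ih hcuv
    exact ih.head ⟨⟨hu, rfl⟩, ⟨hv, hl.symm⟩, hcuv, hduv⟩

lemma Chain.of_union_or_exists_mem (h : Chain G (A ∪ B) c r x y) :
    Chain G B c r x y ∨ ∃ a ∈ A, Chain G (A ∪ B) c r x a ∧ Chain G (A ∪ B) c r a y := by
  induction h using Relation.ReflTransGen.head_induction_on with
  | refl => exact Or.inl .refl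
  | @head u v huv hvy ih =>
    rcases ih with hB | ⟨a, ha, hva, hay⟩
    · rcases huv.1 with hu | hu
      · exact Or.inr ⟨u, hu, .refl, hvy.head huv⟩
      · rcases huv.2.1 with hv | hv
        · exact Or.inr ⟨v, hv, .single huv, hvy⟩
        · exact Or.inl (hB.head ⟨hu, hv, huv.2.2⟩)
    · exact Or.inr ⟨a, ha, hva.head huv, hay⟩

/- The excursions into `B` are shorter than `d`, so the vertices in `A` met by the chain form a
chain at the scale `d + 2 * r`. -/
lemma Chain.exists_chain_of_union (hB : ChainsBounded G B c r d) (hx : x ∈ A)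
    (h : Chain G (A ∪ B) c r x y) :
    ∃ a, Chain G A c (d + 2 * r) x a ∧ DistLE G (d + r) a y := by
  suffices H : ∃ a ∈ A, Chain G A c (d + 2 * r) x a ∧ c a = c y ∧
      (a = y ∨ ∃ b, DistLE G r a b ∧ y ∈ B ∧ Chain G B c r b y) by
    obtain ⟨a, -, hxa, -, rfl | ⟨b, hab, -, hby⟩⟩ := H
    · exact ⟨a, hxa, .refl G _ a⟩
    · exact ⟨a, hxa, hab.trans (hB _ _ hby) (by omega)⟩
  induction h with
  | refl => exact ⟨x, hx, .refl, rfl, Or.inl rfl⟩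
  | @tail u v _ huv ih =>
    obtain ⟨a, ha, hxa, hau, hexc⟩ := ih
    have hav : c a = c v := hau.trans huv.2.2.1
    rcases huv.2.1 with hv | hv
    · refine ⟨v, hv, hxa.tail ⟨ha, hv, hav, ?_⟩, rfl, Or.inl rfl⟩
      rcases hexc with rfl | ⟨b, hab, -, hbu⟩
      · exact huv.2.2.2.mono (by omega)
      · exact (hab.trans (hB _ _ hbu) le_rfl).trans huv.2.2.2 (by omega)
    · refine ⟨a, ha, hxa, hav, Or.inr ?_⟩
      rcases hexc with rfl | ⟨b, hab, hu, hbu⟩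
      · exact ⟨v, huv.2.2.2, hv, .refl⟩
      · exact ⟨b, hab, hv, hbu.tail ⟨hu, hv, huv.2.2⟩⟩

lemma ChainsBounded.union (hB : ChainsBounded G B c r d) (hA : ChainsBounded G A c (d + 2 * r) D) :
    ChainsBounded G (A ∪ B) c r (D + 2 * (d + r)) := by
  intro x y hxy
  rcases hxy.of_union_or_exists_mem with hxy | ⟨a, ha, hxa, hay⟩
  · exact (hB x y hxy).mono (by omega)
  · obtain ⟨x', hx', hxx'⟩ := hxa.symm.exists_chain_of_union hB ha
    obtain ⟨y', hy', hyy'⟩ := hay.exists_chain_of_union hB ha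
    have hx'y' : DistLE G D x' y' := hA x' y' (hx'.symm.trans hy')
    exact (hxx'.symm.trans hx'y' le_rfl).trans hyy' (by omega)

namespace HasColoring

lemma mono (h : HasColoring G B m r D) (hA : A ⊆ B) (hm : m ≤ m') (hr : r' ≤ r) (hD : D ≤ D') :
    HasColoring G A m' r' D' := by
  obtain ⟨c, hc, hb⟩ := h
  exact ⟨c, fun x hx => (hc x (hA hx)).trans_le hm, hb.mono hA hr hD⟩

lemma empty (G : SimpleGraph V) (m r D : ℕ) : HasColoring G ∅ m r D := by
  refine ⟨fun _ => 0, fun x hx => hx.elim, fun x y hxy => ?_⟩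
  exact hxy.eq_of_notMem (Set.notMem_empty x) ▸ .refl G D x

lemma transfer {A' : Set V'} (h : HasColoring G' A' m r' D') (f : V → V') (hf : Set.MapsTo f A A')
    (hr : ∀ x ∈ A, ∀ y ∈ A, DistLE G r x y → DistLE G' r' (f x) (f y))
    (hD : ∀ x ∈ A, ∀ y ∈ A, DistLE G' D' (f x) (f y) → DistLE G D x y) :
    HasColoring G A m r D := by
  obtain ⟨c, hc, hb⟩ := h
  refine ⟨c ∘ f, fun x hx => hc _ (hf hx), fun x y hxy => ?_⟩
  by_cases hx : x ∈ A
  · refine hD x hx y (hxy.mem_iff.1 hx) (hb _ _ (Relation.ReflTransGen.lift f ?_ _ _ hxy))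
    exact fun a b hab =>
      ⟨hf hab.1, hf hab.2.1, hab.2.2.1, hr a hab.1 b hab.2.1 hab.2.2.2⟩
  · exact hxy.eq_of_notMem hx ▸ .refl G D x

lemma of_parametrization {α : Type*} {f : α → V'} {g : α → V} {A' : Set V'}
    (h : HasColoring G' A' m r' D') (hf : ∀ i, f i ∈ A') (hg : A ⊆ Set.range g)
    (hr : ∀ i j, DistLE G r (g i) (g j) → DistLE G' r' (f i) (f j))
    (hD : ∀ i j, DistLE G' D' (f i) (f j) → DistLE G D (g i) (g j)) : HasColoring G A m r D := by
  rcases A.eq_empty_or_nonempty with rfl | ⟨_, hx⟩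
  · exact .empty G m r D
  obtain ⟨i, -⟩ := hg hx
  have : Nonempty α := ⟨i⟩
  choose! s hs using show ∀ x ∈ A, ∃ i, g i = x from fun x hx => hg hx
  refine h.transfer (f ∘ s) (fun x _ => hf (s x)) (fun x hx y hy hxy => hr _ _ ?_)
    fun x hx y hy hxy => ?_
  · rwa [hs x hx, hs y hy]
  · simpa only [hs x hx, hs y hy] using hD _ _ hxy

lemma of_subset_neighborhood (h : HasColoring G B m (r + 2 * s) D) (hAB : A ⊆ neighborhood G s B) :
    HasColoring G A m r (D + 2 * s) := by
  choose! f hfB hfs using hAB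
  refine h.transfer f (fun x hx => hfB hx) (fun x hx y hy hxy => ?_) (fun x hx y hy hxy => ?_)
  · exact ((hfs hx).symm.trans hxy le_rfl).trans (hfs hy) (by omega)
  · exact ((hfs hx).trans hxy le_rfl).trans (hfs hy).symm (by omega)

lemma of_separated {ι : Type*} (label : V → ι)
    (hlabel : ∀ x ∈ A, ∀ y ∈ A, DistLE G r x y → label x = label y)
    (h : ∀ i, HasColoring G (A ∩ label ⁻¹' {i}) m r D) : HasColoring G A m r D := by
  choose c hc hb using h
  refine ⟨fun x => c (label x) x, fun x hx => hc _ x ⟨hx, rfl⟩, fun x y hxy => ?_⟩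
  refine ChainsBounded.of_fibers hb x y (Relation.ReflTransGen.mono (fun a b hab => ?_) _ _ hxy)
  obtain ⟨ha, hb, hcab, hdab⟩ := hab
  exact ⟨ha, hb, Prod.ext (hlabel a ha b hb hdab) hcab, hdab⟩

lemma union (hB : HasColoring G B m r d) (hA : HasColoring G A m (d + 2 * r) D) :
    HasColoring G (A ∪ B) m r (D + 2 * (d + r)) := by
  classical
  obtain ⟨cA, hcA, hbA⟩ := hA
  obtain ⟨cB, hcB, hbB⟩ := hB
  have hcA_eq : Set.EqOn (A.piecewise cA cB) cA A := Set.piecewise_eqOn A cA cB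
  have hcB_eq : Set.EqOn (A.piecewise cA cB) cB (B \ A) :=
    (Set.piecewise_eqOn_compl A cA cB).mono fun _ hx => hx.2
  refine ⟨A.piecewise cA cB, fun x hx => ?_, ?_⟩
  · by_cases hxA : x ∈ A
    · exact (hcA_eq hxA).trans_lt (hcA x hxA)
    · have hxB : x ∈ B := hx.resolve_left hxA
      exact (hcB_eq ⟨hxB, hxA⟩).trans_lt (hcB x hxB)
  · rw [← Set.union_sdiff_self]
    exact ((hbB.mono Set.sdiff_subset le_rfl le_rfl).congr hcB_eq).union (hbA.congr hcA_eq)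

end HasColoring

namespace FamilyAsdimLT

variable {ι ι' : Type*} {F H : ι → Set V}

lemma of_subset {E : ι' → Set V} (h : FamilyAsdimLT G E m) (hF : ∀ i, ∃ k, F i ⊆ E k) :
    FamilyAsdimLT G F m := by
  intro r
  obtain ⟨D, hD⟩ := h r
  refine ⟨D, fun i => ?_⟩
  obtain ⟨k, hk⟩ := hF i
  exact (hD k).mono hk le_rfl le_rfl le_rfl

lemma of_subset_neighborhood (h : FamilyAsdimLT G H m) (s : ℕ)
    (hF : ∀ i, F i ⊆ neighborhood G s (H i)) : FamilyAsdimLT G F m := by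
  intro r
  obtain ⟨D, hD⟩ := h (r + 2 * s)
  exact ⟨D + 2 * s, fun i => (hD i).of_subset_neighborhood (hF i)⟩

lemma of_sum {F : ι ⊕ ι' → Set V} (h : FamilyAsdimLT G (fun i => F (.inl i)) m)
    (h' : FamilyAsdimLT G (fun i => F (.inr i)) m) : FamilyAsdimLT G F m := by
  intro r
  obtain ⟨D, hD⟩ := h r
  obtain ⟨D', hD'⟩ := h' r
  refine ⟨max D D', ?_⟩
  rintro (i | i)
  · exact (hD i).mono subset_rfl le_rfl le_rfl (le_max_left D D')
  · exact (hD' i).mono subset_rfl le_rfl le_rfl (le_max_right D D')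

end FamilyAsdimLT

end Colorings

/-! ### Asymptotic dimension in terms of colourings -/

lemma exists_subset_succ_of_encard_le {α : Type*} {S : ℕ → Set α} (hS : Antitone S) {m : ℕ}
    (hcard : (S 0).encard ≤ m) (hne : (S m).Nonempty) : ∃ j < m, S j ⊆ S (j + 1) := by
  by_contra! hcon
  have hfin : ∀ i, (S i).Finite := fun i =>
    (Set.finite_of_encard_le_coe hcard).subset (hS i.zero_le)
  have hdecr : ∀ i ≤ m, (S i).encard + i ≤ m := by
    intro i
    induction i with
    | zero => simpa using hcard
    | succ i ih =>
      intro hi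
      have hlt : (S (i + 1)).encard < (S i).encard :=
        (hfin (i + 1)).encard_lt_encard ⟨hS i.le_succ, hcon i hi⟩
      calc (S (i + 1)).encard + (i + 1 : ℕ) = (S (i + 1)).encard + 1 + i := by
            push_cast; ring
        _ ≤ (S i).encard + i := by gcongr; exact Order.add_one_le_of_lt hlt
        _ ≤ m := ih (by omega)
  have h : ((1 + m : ℕ) : ℕ∞) ≤ m := by
    push_cast
    exact (add_le_add_left (Set.one_le_encard_iff_nonempty.2 hne) _).trans (hdecr m le_rfl)
  exact absurd (Nat.cast_le.1 h) (by omega)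

/-- The members of the cover `𝒰` that contain the closed ball of radius `ρ` around `x`. -/
def membersAround {X : Type*} [PseudoEMetricSpace X] (𝒰 : Set (Set X)) (ρ : ℕ) (x : X) :
    Set (Set X) :=
  {U ∈ 𝒰 | ∀ y, edist x y ≤ ρ → y ∈ U}

section MetricSpace

variable {X : Type*} [PseudoEMetricSpace X] {n : ℕ}

lemma membersAround_antitone (𝒰 : Set (Set X)) (x : X) : Antitone (membersAround 𝒰 · x) :=
  fun _ _ h _ hU => ⟨hU.1, fun y hy => hU.2 y (hy.trans (by gcongr))⟩

lemma membersAround_subset_of_edist_le {𝒰 : Set (Set X)} {x y : X} {ρ r σ : ℕ}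
    (hxy : edist x y ≤ r) (h : ρ + r ≤ σ) : membersAround 𝒰 σ x ⊆ membersAround 𝒰 ρ y := by
  refine fun U hU => ⟨hU.1, fun z hz => hU.2 z ((edist_triangle x y z).trans ?_)⟩
  calc edist x y + edist y z ≤ r + ρ := add_le_add hxy hz
    _ ≤ σ := by exact_mod_cast (by omega : r + ρ ≤ σ)

lemma UniformlyBounded.exists_edist_le {𝒱 : Set (Set X)} (h : UniformlyBounded 𝒱) :
    ∃ D : ℕ, ∀ A ∈ 𝒱, ∀ x ∈ A, ∀ y ∈ A, edist x y ≤ D := by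
  obtain ⟨D, hD⟩ := ENNReal.exists_nat_gt h.ne
  refine ⟨D, fun A hA x hx y hy => (Metric.edist_le_ediam_of_mem hx hy).trans (le_trans ?_ hD.le)⟩
  exact le_iSup₂ (f := fun A (_ : A ∈ 𝒱) => Metric.ediam A) A hA

lemma AsdimLE.mono {m : ℕ} (h : AsdimLE X m) (hmn : m ≤ n) : AsdimLE X n := by
  intro 𝒱 hcov hbdd
  obtain ⟨𝒰, hcov', hbdd', hmult, href⟩ := h 𝒱 hcov hbdd
  exact ⟨𝒰, hcov', hbdd', fun x => (hmult x).trans (by gcongr), href⟩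

lemma AsdimLE.exists_cover (h : AsdimLE X n) (ρ : ℕ) :
    ∃ 𝒰 : Set (Set X), UniformlyBounded 𝒰 ∧ MultiplicityLE 𝒰 (n + 1) ∧
      ∀ x, (membersAround 𝒰 ρ x).Nonempty := by
  set L : ENNReal := ((ρ + 1 : ℕ) : ENNReal) with hL
  have hcov : OpenCover (Set.range fun x : X => Metric.eball x L) := by
    refine ⟨Set.forall_mem_range.2 fun x => Metric.isOpen_eball, ?_⟩
    exact Set.eq_univ_of_forall fun x => ⟨_, ⟨x, rfl⟩, Metric.mem_eball_self (by simp [hL])⟩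
  have hbdd : UniformlyBounded (Set.range fun x : X => Metric.eball x L) := by
    refine lt_of_le_of_lt (b := 2 * L) (iSup₂_le ?_)
      (ENNReal.mul_lt_top (by simp) (ENNReal.natCast_lt_top _))
    exact Set.forall_mem_range.2 fun x => Metric.ediam_eball_le
  obtain ⟨𝒰, -, hbdd', hmult, href⟩ := h _ hcov hbdd
  refine ⟨𝒰, hbdd', hmult, fun x => ?_⟩
  obtain ⟨U, hU, hxU⟩ := href _ ⟨x, rfl⟩
  refine ⟨U, hU, fun y hy => hxU ?_⟩
  rw [Metric.mem_eball, edist_comm]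
  exact hy.trans_lt (by rw [hL]; exact_mod_cast ρ.lt_succ_self)

/- The colour of `x` is an index `j` such that the members of the cover around the `j * r`-ball at
`x` even contain the `(j + 1) * r`-ball. Along a monochromatic chain these members can only
increase. -/
lemma AsdimLE.exists_coloring (h : AsdimLE X n) (r : ℕ) :
    ∃ (D : ℕ) (c : X → ℕ), (∀ x, c x < n + 1) ∧
      ∀ x y, Relation.ReflTransGen (fun a b => c a = c b ∧ edist a b ≤ r) x y → edist x y ≤ D := by
  obtain ⟨𝒰, hbdd, hmult, hne⟩ := h.exists_cover ((n + 1) * r)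
  obtain ⟨D, hD⟩ := hbdd.exists_edist_le
  have hanti : ∀ x, Antitone fun j => membersAround 𝒰 (j * r) x := fun x _ _ hij =>
    membersAround_antitone 𝒰 x (Nat.mul_le_mul_right r hij)
  have hcolor : ∀ x, ∃ j < n + 1,
      membersAround 𝒰 (j * r) x ⊆ membersAround 𝒰 ((j + 1) * r) x := by
    intro x
    have hsub : membersAround 𝒰 (0 * r) x ⊆ {U | U ∈ 𝒰 ∧ x ∈ U} :=
      fun U hU => ⟨hU.1, hU.2 x (by simp)⟩
    exact exists_subset_succ_of_encard_le (hanti x)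
      ((Set.encard_le_encard hsub).trans (hmult x)) (hne x)
  choose c hc hcsub using hcolor
  refine ⟨D, c, hc, fun x y hxy => ?_⟩
  have hsub : membersAround 𝒰 ((c x + 1) * r) x ⊆ membersAround 𝒰 ((c y + 1) * r) y := by
    induction hxy with
    | refl => exact subset_rfl
    | @tail a b _ hab ih =>
      refine ih.trans (subset_trans ?_ (hcsub b))
      exact membersAround_subset_of_edist_le hab.2 (by rw [hab.1, add_one_mul])
  obtain ⟨U, hU⟩ := hne x
  have hUx := hanti x (hc x) hU
  exact hD U hU.1 x (hUx.2 x (by simp)) y ((hsub hUx).2 y (by simp))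

lemma asdim_le_natCast_iff : asdim X ≤ n ↔ AsdimLE X n := by
  refine ⟨fun h => ?_, fun h => iInf₂_le n h⟩
  by_contra hn
  have hlt : ((n + 1 : ℕ) : ℕ∞) ≤ asdim X := le_iInf₂ fun m hm => by
    by_contra hmn
    exact hn (hm.mono (by exact_mod_cast Order.lt_add_one_iff.1 (by exact_mod_cast not_le.1 hmn)))
  exact absurd (Nat.cast_le.1 (hlt.trans h)) (by omega)

end MetricSpace

/-- The graph has a uniformly bounded cover of multiplicity at most `m` with Lebesgue number at
least `k`, that is, such that every ball of radius `k` lies in a member. -/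
def HasLebesgueCover {V : Type*} (G : SimpleGraph V) (m k : ℕ) : Prop :=
  ∃ (𝒰 : Set (Set V)) (D : ℕ), (∀ x, ∃ U ∈ 𝒰, ∀ y, DistLE G k x y → y ∈ U) ∧
    (∀ U ∈ 𝒰, ∀ x ∈ U, ∀ y ∈ U, DistLE G D x y) ∧ MultiplicityLE 𝒰 m

section GraphMetric

variable {V : Type*} {G : SimpleGraph V} {n : ℕ}

lemma edist_graphMetric_le_iff (r : ℕ) (x y : V) :
    letI := graphMetric G; edist x y ≤ (r : ENNReal) ↔ DistLE G r x y := by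
  change ((G.edist x y : ENNReal) ≤ r) ↔ _
  rw [DistLE, ← ENat.toENNReal_coe, ENat.toENNReal_le]

lemma isOpen_graphMetric (A : Set V) : letI := graphMetric G; IsOpen A := by
  let := graphMetric G
  refine EMetric.isOpen_iff.2 fun x hx => ⟨1, by simp, fun y hy => ?_⟩
  have hyx : G.edist y x < 1 := by
    have hy : (G.edist y x : ENNReal) < 1 := hy
    exact_mod_cast hy
  rw [Order.lt_one_iff, SimpleGraph.edist_eq_zero_iff] at hyx
  rwa [hyx]

lemma AsdimLE.asdimLT_range {X : Type*} [PseudoEMetricSpace X] (h : AsdimLE X n) (f : X → V)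
    (hf : ∀ x y, edist x y = (G.edist (f x) (f y) : ENNReal)) :
    AsdimLT G (Set.range f) (n + 1) := by
  intro r
  rcases isEmpty_or_nonempty X with hX | hX
  · exact ⟨0, by rw [Set.range_eq_empty]; exact .empty G _ r 0⟩
  have hdist : ∀ (s : ℕ) {a b : V}, a ∈ Set.range f → b ∈ Set.range f →
      (edist (Function.invFun f a) (Function.invFun f b) ≤ s ↔ DistLE G s a b) := by
    intro s a b ha hb
    rw [hf, Function.invFun_eq ha, Function.invFun_eq hb]
    exact edist_graphMetric_le_iff s a b
  obtain ⟨D, c, hc, hbdd⟩ := h.exists_coloring r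
  refine ⟨D, c ∘ Function.invFun f, fun x _ => hc _, fun x y hxy => ?_⟩
  by_cases hx : x ∈ Set.range f
  · rw [← hdist D hx (hxy.mem_iff.1 hx)]
    refine hbdd _ _ (Relation.ReflTransGen.lift (Function.invFun f) (fun a b hab => ?_) _ _ hxy)
    exact ⟨hab.2.2.1, (hdist r hab.1 hab.2.1).2 hab.2.2.2⟩
  · exact hxy.eq_of_notMem hx ▸ .refl G D x

lemma asdimLT_univ_of_graphAsdim_le (h : graphAsdim G ≤ n) : AsdimLT G Set.univ (n + 1) := by
  let := graphMetric G
  rw [← Set.range_id]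
  exact (asdim_le_natCast_iff.1 h).asdimLT_range id fun _ _ => rfl

lemma asdimLT_of_setAsdim_add_one_le {A : Set V} (h : setAsdim G A + 1 ≤ n) : AsdimLT G A n := by
  let := graphMetric G
  obtain ⟨e, rfl⟩ : ∃ e, n = e + 1 :=
    Nat.exists_eq_succ_of_ne_zero (by rintro rfl; simp at h)
  have he : asdim A ≤ e :=
    (ENat.add_le_add_iff_right (ENat.natCast_ne_top 1)).1 (by exact_mod_cast h)
  simpa only [Subtype.range_coe] using
    (asdim_le_natCast_iff.1 he).asdimLT_range ((↑) : A → V) fun _ _ => rfl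

lemma asdimLE_of_forall_hasLebesgueCover [Nonempty V]
    (h : ∀ k : ℕ, 0 < k → HasLebesgueCover G (n + 1) k) :
    letI := graphMetric G; AsdimLE V n := by
  let := graphMetric G
  intro 𝒱 _ hbdd
  obtain ⟨K, hK⟩ := hbdd.exists_edist_le
  obtain ⟨𝒰, D, hball, hD, hmult⟩ := h (K + 1) (by omega)
  refine ⟨𝒰, ⟨fun A _ => isOpen_graphMetric A, ?_⟩, ?_, hmult, fun A hA => ?_⟩
  · refine Set.eq_univ_of_forall fun x => ?_
    obtain ⟨U, hU, hx⟩ := hball x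
    exact ⟨U, hU, hx x (.refl G _ x)⟩
  · refine lt_of_le_of_lt (b := (D : ENNReal)) (iSup₂_le fun U hU => ?_) (by simp)
    exact Metric.ediam_le fun x hx y hy => (edist_graphMetric_le_iff D x y).2 (hD U hU x hx y hy)
  · rcases A.eq_empty_or_nonempty with rfl | ⟨x, hx⟩
    · obtain ⟨U, hU, -⟩ := hball (Classical.arbitrary V)
      exact ⟨U, hU, Set.empty_subset U⟩
    · obtain ⟨U, hU, hxU⟩ := hball x
      have hAK : ∀ y ∈ A, DistLE G K x y := fun y hy =>
        (edist_graphMetric_le_iff K x y).1 (hK A hA x hx y hy)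
      exact ⟨U, hU, fun y hy => hxU y ((hAK y hy).mono K.le_succ)⟩

end GraphMetric

/-! ### Gluing covers of pieces along lower dimensional boundaries -/

lemma encard_image_le_card {α β γ : Type*} {s : Set α} {f : α → β} {g : α → γ} (F : Finset γ)
    (hg : ∀ a ∈ s, g a ∈ F) (hfg : ∀ a ∈ s, ∀ b ∈ s, g a = g b → f a = f b) :
    (f '' s).encard ≤ F.card := by
  obtain ⟨t, hts, hft⟩ := s.exists_subset_bijOn f
  have hinj : Set.InjOn g t := fun a ha b hb hab =>
    hft.injOn ha hb (hfg a (hts ha) b (hts hb) hab)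
  rw [← hft.image_eq, ← Set.encard_coe_eq_coe_finsetCard F]
  exact (Set.encard_image_le f t).trans
    (Set.encard_le_encard_of_injOn (fun a ha => hg a (hts ha)) hinj)

/-- A partition of a graph into pieces, with a function `height` that measures the distance from the
boundary of the pieces, a colouring of the collar of the boundary with `n` colours whose
monochromatic chains are bounded by `d`, and a colouring of the pieces with `n + 1` colours whose
monochromatic chains are bounded by `D` at the larger scale `2 * (k + d)`. -/
structure CollaredPartition {V : Type*} (G : SimpleGraph V) (ι : Type*) (n k d D : ℕ) where
  /-- the piece that contains a given vertex -/
  piece : V → ι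
  height : V → ℕ
  collarColor : V → ℕ
  pieceColor : V → ℕ
  scale_pos : 0 < k
  height_le : ∀ x y, DistLE G k x y → height x ≤ height y + k
  height_le_of_piece_ne : ∀ x y, DistLE G k x y → piece x ≠ piece y → height x ≤ k
  collarColor_lt : ∀ x, height x ≤ 3 * k * (n + 1) + k → collarColor x < n
  collar_bounded :
    ChainsBounded G {x | height x ≤ 3 * k * (n + 1) + k} collarColor (2 * k) d
  pieceColor_le : ∀ x, pieceColor x ≤ n
  piece_bounded :
    ChainsBounded G Set.univ (fun x => (piece x, pieceColor x)) (2 * (k + d)) D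

namespace CollaredPartition

/-- Around a vertex of the collar with colour `j`, the cover switches from the boundary to the
pieces at this height. -/
def threshold (k j : ℕ) : ℕ := 3 * k * (j + 1)

lemma threshold_add_le {k a b : ℕ} (hab : a < b) : threshold k a + 3 * k ≤ threshold k b :=
  calc threshold k a + 3 * k = 3 * k * (a + 1 + 1) := by rw [threshold]; ring
    _ ≤ threshold k b := Nat.mul_le_mul_left _ (by omega)

lemma le_threshold (k j : ℕ) : 3 * k ≤ threshold k j := Nat.le_mul_of_pos_right _ (by omega)

lemma card_filter_add_card_filter_le {k : ℕ} (hk : 0 < k) (n h : ℕ) :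
    ((Finset.range n).filter fun j => h ≤ threshold k j).card +
      ((Finset.range n).filter fun j => threshold k j ≤ h + 2 * k).card ≤ n + 1 := by
  rw [← Finset.card_union_add_card_inter]
  refine add_le_add ?_ (Finset.card_le_one.2 fun a ha b hb => ?_)
  · calc _ ≤ (Finset.range n).card := Finset.card_le_card
          (Finset.union_subset (Finset.filter_subset _ _) (Finset.filter_subset _ _))
      _ = n := Finset.card_range n
  · simp only [Finset.mem_inter, Finset.mem_filter] at ha hb
    by_contra hne
    rcases lt_or_gt_of_ne hne with hab | hab
    · have := threshold_add_le (k := k) hab; omega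
    · have := threshold_add_le (k := k) hab; omega

variable {V ι : Type*} {G : SimpleGraph V} {n k d D : ℕ} (P : CollaredPartition G ι n k d D)
  {u u' v v' x y : V}

/-- The neighbourhood of the boundary that is coloured by `collarColor`. -/
def collar : Set V := {x | P.height x ≤ threshold k n + k}

/-- The vertices lie in the same monochromatic component of the collar. -/
abbrev CollarChain : V → V → Prop := Chain G P.collar P.collarColor (2 * k)

/-- The vertices lie in the same monochromatic component of a piece. -/
abbrev PieceChain : V → V → Prop :=
  Chain G Set.univ (fun x => (P.piece x, P.pieceColor x)) (2 * (k + d))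

/-- A vertex of the piece `i` in the same monochromatic component of the collar as `v`, if there is
one. -/
noncomputable def rep (v : V) (i : ι) : V :=
  haveI : Nonempty V := ⟨v⟩
  Classical.epsilon fun w => P.CollarChain v w ∧ P.piece w = i

/-- The member of the cover at the component of `v` in the collar. -/
def boundarySet (v : V) : Set V :=
  {y | P.height y ≤ threshold k (P.collarColor v) ∧ ∃ v', P.CollarChain v v' ∧ DistLE G k y v'}

/-- The vertex `v` of the collar assigns `y` to the member of the cover at the component of `u`. -/
def Assigns (v y u : V) : Prop :=
  v ∈ P.collar ∧ DistLE G k y v ∧ threshold k (P.collarColor v) ≤ P.height y + 2 * k ∧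
    P.PieceChain u (P.rep v (P.piece u))

/-- The member of the cover at the component of `u` in its piece. -/
def pieceSet (u : V) : Set V :=
  {y | P.piece y = P.piece u ∧ (∃ u', P.PieceChain u u' ∧ DistLE G (k + d) y u') ∧
    (threshold k n ≤ P.height y ∨ ∃ v, P.Assigns v y u)}

lemma PieceChain.piece_eq (h : P.PieceChain u u') : P.piece u = P.piece u' :=
  (Prod.ext_iff.1 (Chain.color_eq h)).1

lemma rep_spec (v : V) :
    P.CollarChain v (P.rep v (P.piece v)) ∧ P.piece (P.rep v (P.piece v)) = P.piece v :=
  Classical.epsilon_spec (p := fun w => P.CollarChain v w ∧ P.piece w = P.piece v) ⟨v, .refl, rfl⟩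

lemma collarChain_congr (h : P.CollarChain v v') (w : V) :
    P.CollarChain v w ↔ P.CollarChain v' w :=
  ⟨fun hw => (Chain.symm h).trans hw, fun hw => h.trans hw⟩

lemma pieceChain_congr (h : P.PieceChain u u') (w : V) : P.PieceChain u w ↔ P.PieceChain u' w :=
  ⟨fun hw => (Chain.symm h).trans hw, fun hw => h.trans hw⟩

lemma rep_congr (h : P.CollarChain v v') (i : ι) : P.rep v i = P.rep v' i := by
  simp only [rep, P.collarChain_congr h]

lemma boundarySet_congr (h : P.CollarChain v v') : P.boundarySet v = P.boundarySet v' := by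
  simp only [boundarySet, P.collarChain_congr h, Chain.color_eq h]

lemma pieceSet_congr (h : P.PieceChain u u') : P.pieceSet u = P.pieceSet u' := by
  simp only [pieceSet, Assigns, P.pieceChain_congr h, PieceChain.piece_eq P h]

lemma piece_eq_of_lt_height (hx : k < P.height x) (hxy : DistLE G k x y) :
    P.piece y = P.piece x := by
  by_contra hne
  exact absurd (P.height_le_of_piece_ne x y hxy (Ne.symm hne)) (not_le.2 hx)

lemma mem_pieceSet_of_threshold_lt (hx : threshold k n + k < P.height x) (hxy : DistLE G k x y) :
    y ∈ P.pieceSet x := by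
  have hheight := P.height_le x y hxy
  refine ⟨P.piece_eq_of_lt_height (by omega) hxy, ⟨x, .refl, hxy.symm.mono (by omega)⟩, ?_⟩
  exact Or.inl (by omega)

lemma mem_boundarySet_of_height_le (hx : P.height x + k ≤ threshold k (P.collarColor x))
    (hxy : DistLE G k x y) : y ∈ P.boundarySet x :=
  ⟨(P.height_le y x hxy.symm).trans hx, x, .refl, hxy.symm⟩

lemma mem_pieceSet_rep (hx : x ∈ P.collar)
    (hheight : threshold k (P.collarColor x) < P.height x + k) (hxy : DistLE G k x y) :
    y ∈ P.pieceSet (P.rep x (P.piece x)) := by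
  obtain ⟨hchain, hpiece⟩ := P.rep_spec x
  have hthreshold := le_threshold k (P.collarColor x)
  have hxy' := P.height_le x y hxy
  refine ⟨(P.piece_eq_of_lt_height (by omega) hxy).trans hpiece.symm, ⟨_, .refl, ?_⟩,
    Or.inr ⟨x, hx, hxy.symm, by omega, by rw [hpiece]⟩⟩
  exact hxy.symm.trans (P.collar_bounded _ _ hchain) le_rfl

lemma distLE_of_mem_boundarySet (hx : x ∈ P.boundarySet v) (hy : y ∈ P.boundarySet v) :
    DistLE G (d + 2 * k) x y := by
  obtain ⟨-, x', hx', hxx'⟩ := hx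
  obtain ⟨-, y', hy', hyy'⟩ := hy
  have hx'y' : DistLE G d x' y' := P.collar_bounded _ _ ((Chain.symm hx').trans hy')
  exact (hxx'.trans hx'y' le_rfl).trans hyy'.symm (by omega)

lemma distLE_of_mem_pieceSet (hx : x ∈ P.pieceSet u) (hy : y ∈ P.pieceSet u) :
    DistLE G (D + 2 * (k + d)) x y := by
  obtain ⟨-, ⟨x', hx', hxx'⟩, -⟩ := hx
  obtain ⟨-, ⟨y', hy', hyy'⟩, -⟩ := hy
  have hx'y' : DistLE G D x' y' := P.piece_bounded _ _ ((Chain.symm hx').trans hy')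
  exact (hxx'.trans hx'y' le_rfl).trans hyy'.symm (by omega)

lemma collarChain_of_distLE (hv : v ∈ P.collar) (hv' : v' ∈ P.collar)
    (hcolor : P.collarColor v = P.collarColor v') (hxv : DistLE G k x v) (hxv' : DistLE G k x v') :
    P.CollarChain v v' :=
  .single ⟨hv, hv', hcolor, hxv.symm.trans hxv' (by omega)⟩

lemma boundarySet_eq_of_mem (hv : v ∈ P.collar) (hv' : v' ∈ P.collar)
    (hx : x ∈ P.boundarySet v) (hx' : x ∈ P.boundarySet v')
    (hcolor : P.collarColor v = P.collarColor v') : P.boundarySet v = P.boundarySet v' := by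
  obtain ⟨-, w, hw, hxw⟩ := hx
  obtain ⟨-, w', hw', hxw'⟩ := hx'
  have hww' : P.CollarChain w w' := P.collarChain_of_distLE ((Chain.mem_iff hw).1 hv)
    ((Chain.mem_iff hw').1 hv') (by rw [← Chain.color_eq hw, ← Chain.color_eq hw', hcolor]) hxw hxw'
  exact P.boundarySet_congr (hw.trans (hww'.trans (Chain.symm hw')))

lemma pieceSet_eq_of_mem (hx : x ∈ P.pieceSet u) (hx' : x ∈ P.pieceSet u')
    (hcolor : P.pieceColor u = P.pieceColor u') : P.pieceSet u = P.pieceSet u' := by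
  obtain ⟨hu, ⟨w, hw, hxw⟩, -⟩ := hx
  obtain ⟨hu', ⟨w', hw', hxw'⟩, -⟩ := hx'
  have hww' : P.PieceChain w w' := by
    have hcolors : (P.piece u, P.pieceColor u) = (P.piece u', P.pieceColor u') :=
      Prod.ext (hu.symm.trans hu') hcolor
    refine .single ⟨Set.mem_univ w, Set.mem_univ w', ?_, hxw.symm.trans hxw' (by omega)⟩
    exact (Chain.color_eq hw).symm.trans (hcolors.trans (Chain.color_eq hw'))
  exact P.pieceSet_congr (hw.trans (hww'.trans (Chain.symm hw')))

lemma pieceSet_eq_of_assigns (hu : P.piece x = P.piece u) (hu' : P.piece x = P.piece u')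
    (hv : P.Assigns v x u) (hv' : P.Assigns v' x u')
    (hcolor : P.collarColor v = P.collarColor v') : P.pieceSet u = P.pieceSet u' := by
  obtain ⟨hv, hxv, -, hchain⟩ := hv
  obtain ⟨hv', hxv', -, hchain'⟩ := hv'
  rw [← hu', hu, ← P.rep_congr (P.collarChain_of_distLE hv hv' hcolor hxv hxv')] at hchain'
  exact P.pieceSet_congr (hchain.trans (Chain.symm hchain'))

lemma encard_boundarySets_le (x : V) :
    (P.boundarySet '' {v ∈ P.collar | x ∈ P.boundarySet v}).encard ≤
      ((Finset.range n).filter fun j => P.height x ≤ threshold k j).card := by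
  refine encard_image_le_card (g := P.collarColor) _ (fun v hv => ?_)
    (fun v hv v' hv' => P.boundarySet_eq_of_mem hv.1 hv'.1 hv.2 hv'.2)
  exact Finset.mem_filter.2 ⟨Finset.mem_range.2 (P.collarColor_lt v hv.1), hv.2.1⟩

lemma encard_pieceSets_le (x : V) : (P.pieceSet '' {u | x ∈ P.pieceSet u}).encard ≤ n + 1 := by
  refine (encard_image_le_card (Finset.range (n + 1)) (g := P.pieceColor)
    (fun u _ => Finset.mem_range.2 (Nat.lt_succ_of_le (P.pieceColor_le u)))
    (fun u hu u' hu' => P.pieceSet_eq_of_mem (x := x) hu hu')).trans ?_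
  rw [Finset.card_range, Nat.cast_add_one]

lemma encard_pieceSets_le_of_lt (hx : P.height x < threshold k n) :
    (P.pieceSet '' {u | x ∈ P.pieceSet u}).encard ≤
      ((Finset.range n).filter fun j => threshold k j ≤ P.height x + 2 * k).card := by
  set s : Set (V × V) := {q | P.piece x = P.piece q.1 ∧ P.Assigns q.2 x q.1}
  have hsub : P.pieceSet '' {u | x ∈ P.pieceSet u} ⊆ (fun q => P.pieceSet q.1) '' s := by
    rintro _ ⟨u, ⟨hu, -, hv⟩, rfl⟩
    obtain ⟨v, hv⟩ := hv.resolve_left (not_le.2 hx)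
    exact ⟨(u, v), ⟨hu, hv⟩, rfl⟩
  refine (Set.encard_le_encard hsub).trans (encard_image_le_card (g := fun q => P.collarColor q.2) _
    (fun q hq => ?_) (fun q hq q' hq' => P.pieceSet_eq_of_assigns hq.1 hq'.1 hq.2 hq'.2))
  exact Finset.mem_filter.2 ⟨Finset.mem_range.2 (P.collarColor_lt _ hq.2.1), hq.2.2.2.1⟩

/-- The cover by the sets at the components of the collar and of the pieces. -/
def cover : Set (Set V) := P.boundarySet '' P.collar ∪ Set.range P.pieceSet

lemma exists_mem_cover (x : V) : ∃ U ∈ P.cover, ∀ y, DistLE G k x y → y ∈ U := by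
  by_cases hx : threshold k n + k < P.height x
  · exact ⟨_, Or.inr ⟨x, rfl⟩, fun y => P.mem_pieceSet_of_threshold_lt hx⟩
  · have hxc : x ∈ P.collar := not_lt.1 hx
    by_cases hheight : P.height x + k ≤ threshold k (P.collarColor x)
    · exact ⟨_, Or.inl ⟨x, hxc, rfl⟩, fun y => P.mem_boundarySet_of_height_le hheight⟩
    · exact ⟨_, Or.inr ⟨_, rfl⟩, fun y => P.mem_pieceSet_rep hxc (not_le.1 hheight)⟩

lemma multiplicityLE_cover : MultiplicityLE P.cover (n + 1) := by
  intro x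
  have hunion : {A | A ∈ P.cover ∧ x ∈ A} ⊆
      P.boundarySet '' {v ∈ P.collar | x ∈ P.boundarySet v} ∪
        P.pieceSet '' {u | x ∈ P.pieceSet u} := by
    rintro _ ⟨⟨v, hv, rfl⟩ | ⟨u, rfl⟩, hx⟩
    · exact Or.inl ⟨v, ⟨hv, hx⟩, rfl⟩
    · exact Or.inr ⟨u, hx, rfl⟩
  refine (Set.encard_le_encard hunion).trans ((Set.encard_union_le _ _).trans ?_)
  rcases lt_or_ge (P.height x) (threshold k n) with hx | hx
  · refine (add_le_add (P.encard_boundarySets_le x) (P.encard_pieceSets_le_of_lt hx)).trans ?_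
    exact_mod_cast card_filter_add_card_filter_le P.scale_pos n (P.height x)
  · have hno : ((Finset.range n).filter fun j => P.height x ≤ threshold k j) = ∅ := by
      refine Finset.filter_eq_empty_iff.2 fun j hj => ?_
      have := threshold_add_le (k := k) (Finset.mem_range.1 hj)
      have := P.scale_pos
      omega
    have hboundary := P.encard_boundarySets_le x
    rw [hno] at hboundary
    simpa using add_le_add hboundary (P.encard_pieceSets_le x)

theorem hasLebesgueCover (P : CollaredPartition G ι n k d D) : HasLebesgueCover G (n + 1) k := by
  refine ⟨P.cover, D + 2 * (k + d), P.exists_mem_cover, ?_, P.multiplicityLE_cover⟩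
  rintro _ (⟨v, -, rfl⟩ | ⟨u, rfl⟩) x hx y hy
  · exact (P.distLE_of_mem_boundarySet hx hy).mono (by omega)
  · exact P.distLE_of_mem_pieceSet hx hy

end CollaredPartition

theorem hasLebesgueCover_of_partition {V ι : Type*} {G : SimpleGraph V} {n k d : ℕ} (hk : 0 < k)
    (piece : V → ι) (height : V → ℕ)
    (hheight : ∀ x y, DistLE G k x y → height x ≤ height y + k)
    (hpiece : ∀ x y, DistLE G k x y → piece x ≠ piece y → height x ≤ k)
    (hcollar : HasColoring G {x | height x ≤ 3 * k * (n + 1) + k} n (2 * k) d)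
    (hpieces : FamilyAsdimLT G (fun i => piece ⁻¹' {i}) (n + 1)) :
    HasLebesgueCover G (n + 1) k := by
  obtain ⟨c, hc, hcb⟩ := hcollar
  obtain ⟨D, hD⟩ := hpieces (2 * (k + d))
  choose e he heb using hD
  refine CollaredPartition.hasLebesgueCover (D := D)
    { piece, height
      collarColor := c
      pieceColor := fun x => e (piece x) x
      scale_pos := hk
      height_le := hheight
      height_le_of_piece_ne := hpiece
      collarColor_lt := hc
      collar_bounded := hcb
      pieceColor_le := fun x => Nat.le_of_lt_succ (he _ x rfl)
      piece_bounded := ChainsBounded.of_fibers fun i => ?_ }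
  simpa only [Set.univ_inter] using heb i

/-! ### Rooted trees of graphs -/

/-- A graph `copy` whose vertices are distributed over the nodes of a rooted forest such that edges
lie within nodes, and a graph `bond` that matches, for every node, some of its vertices with some
vertices of its parent. The components of `bond` meet at most `size` nodes. -/
structure RootedTreeOfGraphs (P T : Type*) where
  /-- the edges within the nodes -/
  copy : SimpleGraph P
  /-- the edges between the nodes -/
  bond : SimpleGraph P
  /-- the node of a vertex -/
  node : P → T
  /-- the distance from the root -/
  depth : T → ℕ
  /-- the parent of a node -/
  parent : T → T
  depth_parent : ∀ t, depth (parent t) = depth t - 1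
  copy_adj : ∀ p q, copy.Adj p q → node p = node q
  bond_adj : ∀ p q, bond.Adj p q →
    (node q = parent (node p) ∧ depth (node p) = depth (node q) + 1) ∨
    (node p = parent (node q) ∧ depth (node q) = depth (node p) + 1)
  bond_unique : ∀ p q q', bond.Adj p q → bond.Adj p q' → node q = node q' → q = q'
  /-- the maximal number of nodes that a component of `bond` meets -/
  size : ℕ
  encard_le : ∀ a : bond.ConnectedComponent,
    {t | ∃ x, node x = t ∧ bond.connectedComponentMk x = a}.encard ≤ size

namespace RootedTreeOfGraphs

variable {P T : Type*} (𝒯 : RootedTreeOfGraphs P T)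

/-- The vertices of the contracted graph. -/
abbrev Vtx : Type _ := 𝒯.bond.ConnectedComponent

/-- The contraction map. -/
abbrev cls (p : P) : 𝒯.Vtx := 𝒯.bond.connectedComponentMk p

/-- The graph obtained by contracting all bonds. -/
def contraction : SimpleGraph 𝒯.Vtx where
  Adj a b := a ≠ b ∧ ∃ x y, 𝒯.cls x = a ∧ 𝒯.cls y = b ∧ (𝒯.copy ⊔ 𝒯.bond).Adj x y
  symm := ⟨fun _ _ ⟨hne, x, y, hx, hy, h⟩ => ⟨hne.symm, y, x, hy, hx, h.symm⟩⟩
  loopless := ⟨fun _ h => h.1 rfl⟩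

lemma exists_copy_adj {a b : 𝒯.Vtx} (h : 𝒯.contraction.Adj a b) :
    ∃ x y, 𝒯.cls x = a ∧ 𝒯.cls y = b ∧ 𝒯.copy.Adj x y := by
  obtain ⟨hne, x, y, rfl, rfl, h | h⟩ := h
  · exact ⟨x, y, rfl, rfl, h⟩
  · exact absurd (SimpleGraph.ConnectedComponent.sound h.reachable) hne

lemma distLE_cls {r : ℕ} {p q : P} (h : DistLE 𝒯.copy r p q) :
    DistLE 𝒯.contraction r (𝒯.cls p) (𝒯.cls q) := by
  refine h.map 𝒯.cls fun x y hxy => ?_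
  by_cases hne : 𝒯.cls x = 𝒯.cls y
  · exact hne ▸ .refl _ _ _
  · exact .of_adj ⟨hne, x, y, rfl, rfl, Or.inl hxy⟩

/-- The ancestor of `t` at depth `d`. -/
def anc (d : ℕ) (t : T) : T := 𝒯.parent^[𝒯.depth t - d] t

/-- The node `s` is `t` or a descendant of `t`. -/
def Below (t s : T) : Prop := 𝒯.depth t ≤ 𝒯.depth s ∧ 𝒯.anc (𝒯.depth t) s = t

variable {𝒯}

lemma anc_parent {d : ℕ} {t : T} (h : d < 𝒯.depth t) : 𝒯.anc d (𝒯.parent t) = 𝒯.anc d t := by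
  unfold anc
  rw [𝒯.depth_parent, ← Function.iterate_succ_apply]
  congr 2
  omega

lemma anc_eq_self {d : ℕ} {t : T} (h : 𝒯.depth t = d) : 𝒯.anc d t = t := by simp [anc, h]

lemma depth_anc {d : ℕ} {t : T} (h : d ≤ 𝒯.depth t) : 𝒯.depth (𝒯.anc d t) = d := by
  have depth_iterate : ∀ i, 𝒯.depth (𝒯.parent^[i] t) = 𝒯.depth t - i := by
    intro i
    induction i with
    | zero => rfl
    | succ i ih => rw [Function.iterate_succ_apply', 𝒯.depth_parent, ih]; omega
  rw [anc, depth_iterate]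
  omega

lemma Below.refl (t : T) : 𝒯.Below t t := ⟨le_rfl, anc_eq_self rfl⟩

lemma Below.eq {t s : T} (h : 𝒯.Below t s) (hd : 𝒯.depth s ≤ 𝒯.depth t) : s = t :=
  (anc_eq_self (le_antisymm hd h.1)).symm.trans h.2

lemma Below.parent {t s : T} (h : 𝒯.Below t s) (hd : 𝒯.depth t < 𝒯.depth s) :
    𝒯.Below t (𝒯.parent s) :=
  ⟨by rw [𝒯.depth_parent]; omega, by rw [anc_parent hd, h.2]⟩

lemma Below.of_parent {t s : T} (h : 𝒯.Below t (𝒯.parent s)) (hd : 𝒯.depth t < 𝒯.depth s) :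
    𝒯.Below t s :=
  ⟨hd.le, by rw [← anc_parent hd, h.2]⟩

lemma below_anc {d : ℕ} {t : T} (h : d ≤ 𝒯.depth t) : 𝒯.Below (𝒯.anc d t) t :=
  ⟨by rwa [depth_anc h], by rw [depth_anc h]⟩

lemma eq_of_bond_of_below {t : T} {a b : P} (h : 𝒯.bond.Adj a b) (ha : 𝒯.Below t (𝒯.node a))
    (hb : ¬𝒯.Below t (𝒯.node b)) : 𝒯.node a = t ∧ 𝒯.node b = 𝒯.parent t := by
  rcases 𝒯.bond_adj a b h with ⟨hparent, -⟩ | ⟨hparent, hdepth⟩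
  · rcases ha.1.lt_or_eq with hlt | heq
    · exact absurd (hparent ▸ ha.parent hlt) hb
    · have hat : 𝒯.node a = t := ha.eq heq.ge
      exact ⟨hat, by rw [hparent, hat]⟩
  · have hle := ha.1
    exact absurd (Below.of_parent (hparent ▸ ha) (by omega)) hb

variable (𝒯) in
open Classical in
/-- The neighbour of `p` in the parent of its node, or `p` if there is none. -/
noncomputable def up (p : P) : P :=
  if h : ∃ q, 𝒯.bond.Adj p q ∧ 𝒯.depth (𝒯.node q) < 𝒯.depth (𝒯.node p) then h.choose else p

variable (𝒯) in
/-- The vertex closest to the root that is identified with `p`. -/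
noncomputable def top (p : P) : P := 𝒯.up^[𝒯.depth (𝒯.node p)] p

variable (𝒯) in
/-- The vertices of the node `t` that are identified with a vertex of the parent of `t`. -/
def joint (t : T) : Set P := {p | 𝒯.node p = t ∧ 𝒯.up p ≠ p}

lemma up_spec {p : P} (h : 𝒯.up p ≠ p) : 𝒯.bond.Adj p (𝒯.up p) ∧
    𝒯.node (𝒯.up p) = 𝒯.parent (𝒯.node p) ∧
    𝒯.depth (𝒯.node p) = 𝒯.depth (𝒯.node (𝒯.up p)) + 1 := by
  by_cases hex : ∃ q, 𝒯.bond.Adj p q ∧ 𝒯.depth (𝒯.node q) < 𝒯.depth (𝒯.node p)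
  · have hup : 𝒯.up p = hex.choose := dif_pos hex
    obtain ⟨hadj, hlt⟩ := hex.choose_spec
    rw [← hup] at hadj hlt
    exact ⟨hadj, (𝒯.bond_adj _ _ hadj).resolve_right fun h => by omega⟩
  · exact absurd (dif_neg hex) h

lemma up_eq {p q : P} (h : 𝒯.bond.Adj p q) (hd : 𝒯.depth (𝒯.node q) < 𝒯.depth (𝒯.node p)) :
    𝒯.up p = q := by
  have hex : ∃ q, 𝒯.bond.Adj p q ∧ 𝒯.depth (𝒯.node q) < 𝒯.depth (𝒯.node p) := ⟨q, h, hd⟩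
  have hup : 𝒯.up p = hex.choose := dif_pos hex
  have hne : 𝒯.up p ≠ p := hup ▸ hex.choose_spec.1.ne'
  have hq : 𝒯.node q = 𝒯.parent (𝒯.node p) :=
    ((𝒯.bond_adj _ _ h).resolve_right fun h => by omega).1
  exact 𝒯.bond_unique p _ _ (up_spec hne).1 h ((up_spec hne).2.1.trans hq.symm)

lemma up_induction {motive : P → Prop} (base : ∀ p, 𝒯.up p = p → motive p)
    (step : ∀ p, 𝒯.up p ≠ p → motive (𝒯.up p) → motive p) (p : P) : motive p := by
  induction hd : 𝒯.depth (𝒯.node p) generalizing p with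
  | zero =>
    by_cases h : 𝒯.up p = p
    · exact base p h
    · have := (up_spec h).2.2
      omega
  | succ d ih =>
    by_cases h : 𝒯.up p = p
    · exact base p h
    · have := (up_spec h).2.2
      exact step p h (ih _ (by omega))

lemma top_eq_self {p : P} (h : 𝒯.up p = p) : 𝒯.top p = p := Function.iterate_fixed h _

lemma top_up (p : P) : 𝒯.top (𝒯.up p) = 𝒯.top p := by
  by_cases h : 𝒯.up p = p
  · rw [h]
  · rw [top, top, (up_spec h).2.2, Function.iterate_succ_apply]

lemma cls_up (p : P) : 𝒯.cls (𝒯.up p) = 𝒯.cls p := by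
  by_cases h : 𝒯.up p = p
  · rw [h]
  · exact (SimpleGraph.ConnectedComponent.sound (up_spec h).1.reachable).symm

lemma cls_top (p : P) : 𝒯.cls (𝒯.top p) = 𝒯.cls p := by
  induction p using up_induction (𝒯 := 𝒯) with
  | base p h => rw [top_eq_self h]
  | step p _ ih => rw [← top_up, ih, cls_up]

lemma top_eq_of_cls_eq {p q : P} (h : 𝒯.cls p = 𝒯.cls q) : 𝒯.top p = 𝒯.top q := by
  obtain ⟨w⟩ := SimpleGraph.ConnectedComponent.exact h
  induction w with
  | nil => rfl
  | cons hadj w ih =>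
    rw [← ih (SimpleGraph.ConnectedComponent.sound w.reachable)]
    rcases 𝒯.bond_adj _ _ hadj with hup | hdown
    · rw [← up_eq hadj (by omega), top_up]
    · rw [← up_eq hadj.symm (by omega), top_up]

variable (𝒯) in
/-- The node closest to the root among those that contain a preimage of `a`. -/
noncomputable def topNode (a : 𝒯.Vtx) : T := 𝒯.node (𝒯.top (Quot.out a))

variable (𝒯) in
/-- The depth of the top node. -/
noncomputable def topDepth (a : 𝒯.Vtx) : ℕ := 𝒯.depth (𝒯.topNode a)

lemma topNode_cls (p : P) : 𝒯.topNode (𝒯.cls p) = 𝒯.node (𝒯.top p) := by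
  rw [topNode, top_eq_of_cls_eq (q := p)]
  exact Quot.out_eq (𝒯.cls p)

lemma topDepth_cls (p : P) : 𝒯.topDepth (𝒯.cls p) = 𝒯.depth (𝒯.node (𝒯.top p)) := by
  rw [topDepth, topNode_cls]

lemma exists_cls_eq_topNode (a : 𝒯.Vtx) : ∃ p, 𝒯.cls p = a ∧ 𝒯.node p = 𝒯.topNode a :=
  ⟨𝒯.top (Quot.out a), (cls_top _).trans (Quot.out_eq a), rfl⟩

lemma topDepth_le (p : P) : 𝒯.topDepth (𝒯.cls p) ≤ 𝒯.depth (𝒯.node p) := by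
  induction p using up_induction (𝒯 := 𝒯) with
  | base p h => rw [topDepth_cls, top_eq_self h]
  | step p h ih =>
    have := (up_spec h).2.2
    rw [cls_up] at ih
    omega

lemma Icc_subset_depths (p : P) : Set.Icc (𝒯.topDepth (𝒯.cls p)) (𝒯.depth (𝒯.node p)) ⊆
    𝒯.depth '' {t | ∃ x, 𝒯.node x = t ∧ 𝒯.cls x = 𝒯.cls p} := by
  induction p using up_induction (𝒯 := 𝒯) with
  | base p h =>
    rw [topDepth_cls, top_eq_self h, Set.Icc_self, Set.singleton_subset_iff]
    exact ⟨_, ⟨p, rfl, rfl⟩, rfl⟩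
  | step p h ih =>
    rw [cls_up] at ih
    intro d hd
    rcases hd.2.eq_or_lt with rfl | hlt
    · exact ⟨_, ⟨p, rfl, rfl⟩, rfl⟩
    · have := (up_spec h).2.2
      exact ih ⟨hd.1, by omega⟩

lemma depth_le_topDepth_add (p : P) :
    𝒯.depth (𝒯.node p) ≤ 𝒯.topDepth (𝒯.cls p) + 𝒯.size := by
  have hencard := ((Set.encard_le_encard (Icc_subset_depths p)).trans
    (Set.encard_image_le _ _)).trans (𝒯.encard_le (𝒯.cls p))
  rw [← Finset.coe_Icc, Set.encard_coe_eq_coe_finsetCard, Nat.card_Icc] at hencard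
  have hcard : 𝒯.depth (𝒯.node p) + 1 - 𝒯.topDepth (𝒯.cls p) ≤ 𝒯.size := by exact_mod_cast hencard
  omega

lemma distLE_bond_top_sub (p : P) :
    DistLE 𝒯.bond (𝒯.depth (𝒯.node p) - 𝒯.topDepth (𝒯.cls p)) p (𝒯.top p) := by
  induction p using up_induction (𝒯 := 𝒯) with
  | base p h => rw [top_eq_self h]; exact .refl _ _ _
  | step p h ih =>
    have hdepth := (up_spec h).2.2
    have htop := topDepth_le (𝒯 := 𝒯) (𝒯.up p)
    rw [top_up, cls_up] at *
    exact (DistLE.of_adj (up_spec h).1).trans ih (by omega)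

lemma distLE_bond_top (p : P) : DistLE 𝒯.bond 𝒯.size p (𝒯.top p) :=
  (distLE_bond_top_sub p).mono (Nat.sub_le_iff_le_add'.2 (depth_le_topDepth_add p))

lemma anc_node {d : ℕ} {p : P} (h : d ≤ 𝒯.topDepth (𝒯.cls p)) :
    𝒯.anc d (𝒯.node p) = 𝒯.anc d (𝒯.topNode (𝒯.cls p)) := by
  induction p using up_induction (𝒯 := 𝒯) with
  | base p hp => rw [topNode_cls, top_eq_self hp]
  | step p hp ih =>
    rw [cls_up] at ih
    obtain ⟨-, hparent, hdepth⟩ := up_spec hp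
    have htop := topDepth_le (𝒯 := 𝒯) (𝒯.up p)
    rw [cls_up] at htop
    rw [← ih h, hparent, anc_parent (by omega)]

lemma exists_mem_joint {d : ℕ} {p : P} (h : 𝒯.topDepth (𝒯.cls p) < d)
    (hd : d ≤ 𝒯.depth (𝒯.node p)) : ∃ q ∈ 𝒯.joint (𝒯.anc d (𝒯.node p)), 𝒯.cls q = 𝒯.cls p := by
  induction p using up_induction (𝒯 := 𝒯) with
  | base p hp => rw [topDepth_cls, top_eq_self hp] at h; omega
  | step p hp ih =>
    rcases hd.eq_or_lt with heq | hlt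
    · exact ⟨p, ⟨(anc_eq_self heq.symm).symm, hp⟩, rfl⟩
    · obtain ⟨-, hparent, hdepth⟩ := up_spec hp
      obtain ⟨q, hq, hqp⟩ := ih (by rwa [cls_up]) (by omega)
      rw [hparent, anc_parent hlt] at hq
      exact ⟨q, hq, hqp.trans (cls_up p)⟩

lemma topDepth_le_of_adj {a b : 𝒯.Vtx} (h : 𝒯.contraction.Adj a b) :
    𝒯.topDepth a ≤ 𝒯.topDepth b + 𝒯.size := by
  obtain ⟨x, y, rfl, rfl, hxy⟩ := 𝒯.exists_copy_adj h
  refine (topDepth_le x).trans ?_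
  rw [𝒯.copy_adj x y hxy]
  exact depth_le_topDepth_add y

/- Leaving the part of the contracted graph below a node is only possible through the vertices that
this node shares with its parent. -/
lemma anc_eq_or_exists_mem_joint {d i : ℕ} {a b : 𝒯.Vtx} (hab : DistLE 𝒯.contraction i a b)
    (ha : d ≤ 𝒯.topDepth a) :
    (d ≤ 𝒯.topDepth b ∧ 𝒯.anc d (𝒯.topNode b) = 𝒯.anc d (𝒯.topNode a)) ∨
    ∃ q ∈ 𝒯.joint (𝒯.anc d (𝒯.topNode a)), 𝒯.topDepth (𝒯.cls q) < d ∧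
      DistLE 𝒯.contraction i a (𝒯.cls q) := by
  obtain ⟨w, hw⟩ := hab.exists_walk
  clear hab
  induction w generalizing i with
  | nil => exact Or.inl ⟨ha, rfl⟩
  | @cons a v b hadj w ih =>
    rw [SimpleGraph.Walk.length_cons] at hw
    obtain ⟨x, y, rfl, rfl, hxy⟩ := 𝒯.exists_copy_adj hadj
    have hnode : 𝒯.node x = 𝒯.node y := 𝒯.copy_adj x y hxy
    by_cases hy : d ≤ 𝒯.topDepth (𝒯.cls y)
    · have hanc : 𝒯.anc d (𝒯.topNode (𝒯.cls y)) = 𝒯.anc d (𝒯.topNode (𝒯.cls x)) := by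
        rw [← anc_node ha, ← anc_node hy, hnode]
      rcases ih hy (i := i - 1) (by omega) with ⟨hb, hanc'⟩ | ⟨q, hq, hqd, hyq⟩
      · exact Or.inl ⟨hb, hanc'.trans hanc⟩
      · exact Or.inr ⟨q, hanc ▸ hq, hqd, (DistLE.of_adj hadj).trans hyq (by omega)⟩
    · obtain ⟨q, hq, hqy⟩ := exists_mem_joint (p := y) (not_le.1 hy)
        (hnode ▸ ha.trans (topDepth_le x))
      rw [← hnode, anc_node ha] at hq
      exact Or.inr ⟨q, hq, hqy ▸ not_le.1 hy, hqy ▸ (DistLE.of_adj hadj).mono (by omega)⟩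

variable (𝒯) in
/-- The bonds between any two nodes form a coarse equivalence, uniformly. -/
def CoarseBonds : Prop :=
  ∀ r, ∃ K, ∀ p p' q q', 𝒯.bond.Adj p p' → 𝒯.bond.Adj q q' → 𝒯.node p = 𝒯.node q →
    𝒯.node p' = 𝒯.node q' → DistLE 𝒯.copy r p q → DistLE 𝒯.copy K p' q'

lemma distLE_sup_of_cls_eq {p q : P} (h : 𝒯.cls p = 𝒯.cls q) :
    DistLE (𝒯.copy ⊔ 𝒯.bond) (2 * 𝒯.size) p q := by
  have hbond : DistLE 𝒯.bond (2 * 𝒯.size) p q :=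
    (distLE_bond_top p).trans (top_eq_of_cls_eq h ▸ (distLE_bond_top q).symm) (by omega)
  exact hbond.map id fun a b hab => .of_adj (Or.inr hab)

lemma distLE_sup_of_walk {a b : 𝒯.Vtx} (w : 𝒯.contraction.Walk a b) {p q : P} (hp : 𝒯.cls p = a)
    (hq : 𝒯.cls q = b) :
    DistLE (𝒯.copy ⊔ 𝒯.bond) ((2 * 𝒯.size + 1) * w.length + 2 * 𝒯.size) p q := by
  induction w generalizing p with
  | nil => exact (distLE_sup_of_cls_eq (hp.trans hq.symm)).mono (by omega)
  | cons hadj w ih =>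
    obtain ⟨x, y, hx, hy, hxy⟩ := 𝒯.exists_copy_adj hadj
    have hpx : DistLE (𝒯.copy ⊔ 𝒯.bond) (2 * 𝒯.size) p x := distLE_sup_of_cls_eq (hp.trans hx.symm)
    have hxy : DistLE (𝒯.copy ⊔ 𝒯.bond) 1 x y := .of_adj (Or.inl hxy)
    refine (hpx.trans hxy le_rfl).trans (ih hy hq) ?_
    rw [SimpleGraph.Walk.length_cons, mul_add]
    omega

/- A walk that leaves a node through a bond can only return through a bond between the same two
nodes. -/
lemma exists_return_bond {p p' q : P} (hadj : 𝒯.bond.Adj p p') (hpq : 𝒯.node p = 𝒯.node q)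
    (w : (𝒯.copy ⊔ 𝒯.bond).Walk p' q) :
    ∃ a b, 𝒯.bond.Adj a b ∧ 𝒯.node a = 𝒯.node p' ∧ 𝒯.node b = 𝒯.node p ∧
      ∃ (w₁ : (𝒯.copy ⊔ 𝒯.bond).Walk p' a) (w₂ : (𝒯.copy ⊔ 𝒯.bond).Walk b q),
        w₁.length + 1 + w₂.length = w.length := by
  rcases 𝒯.bond_adj _ _ hadj with ⟨hparent, hdepth⟩ | ⟨hparent, hdepth⟩
  · obtain ⟨a, b, ha, hb, hab, hw⟩ :=
      exists_exit_of_walk {x | ¬𝒯.Below (𝒯.node p) (𝒯.node x)} w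
        (fun hbelow => by have := hbelow.1; omega) (fun hq => hq (hpq ▸ Below.refl _))
    have hb : 𝒯.Below (𝒯.node p) (𝒯.node b) := not_not.1 hb
    rcases hab with hab | hab
    · exact absurd (𝒯.copy_adj _ _ hab ▸ hb) ha
    · obtain ⟨hbp, hap⟩ := eq_of_bond_of_below hab.symm hb ha
      exact ⟨a, b, hab, hap.trans hparent.symm, hbp, hw⟩
  · obtain ⟨a, b, ha, hb, hab, hw⟩ :=
      exists_exit_of_walk {x | 𝒯.Below (𝒯.node p') (𝒯.node x)} w (Below.refl _)
        (fun hbelow => by have := hbelow.1; rw [← hpq] at this; omega)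
    rcases hab with hab | hab
    · exact absurd (show 𝒯.Below _ _ from 𝒯.copy_adj _ _ hab ▸ ha) hb
    · obtain ⟨hap, hbp⟩ := eq_of_bond_of_below hab ha hb
      exact ⟨a, b, hab, hap, hbp.trans hparent.symm, hw⟩

lemma CoarseBonds.exists_distLE_copy_of_walk (h : 𝒯.CoarseBonds) (L : ℕ) :
    ∃ K, ∀ {p q : P} (w : (𝒯.copy ⊔ 𝒯.bond).Walk p q), 𝒯.node p = 𝒯.node q → w.length ≤ L →
      DistLE 𝒯.copy K p q := by
  induction L with
  | zero =>
    refine ⟨0, fun {p q} w _ hw => ?_⟩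
    rw [SimpleGraph.Walk.eq_of_length_eq_zero (Nat.le_zero.1 hw)]
    exact .refl _ _ _
  | succ L ih =>
    obtain ⟨K, hK⟩ := ih
    obtain ⟨K', hK'⟩ := h K
    refine ⟨1 + K + K', fun {p q} w hpq hw => ?_⟩
    cases w with
    | nil => exact .refl _ _ _
    | @cons _ p' _ hadj w =>
      rw [SimpleGraph.Walk.length_cons] at hw
      rcases hadj with hadj | hadj
      · have hp'q := hK w ((𝒯.copy_adj _ _ hadj).symm.trans hpq) (by omega)
        exact (DistLE.of_adj hadj).trans hp'q (by omega)
      · obtain ⟨a, b, hab, ha, hb, w₁, w₂, hlen⟩ := exists_return_bond hadj hpq w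
        have hp'a : DistLE 𝒯.copy K p' a := hK w₁ ha.symm (by omega)
        have hpb : DistLE 𝒯.copy K' p b := hK' p' p a b hadj.symm hab ha.symm hb.symm hp'a
        exact hpb.trans (hK w₂ (hb.trans hpq) (by omega)) (by omega)

lemma CoarseBonds.exists_distLE_copy (h : 𝒯.CoarseBonds) (r : ℕ) :
    ∃ K, ∀ p q : P, 𝒯.node p = 𝒯.node q → DistLE 𝒯.contraction r (𝒯.cls p) (𝒯.cls q) →
      DistLE 𝒯.copy K p q := by
  obtain ⟨K, hK⟩ := h.exists_distLE_copy_of_walk ((2 * 𝒯.size + 1) * r + 2 * 𝒯.size)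
  refine ⟨K, fun p q hpq hr => ?_⟩
  obtain ⟨w, hw⟩ := hr.exists_walk
  obtain ⟨w', hw'⟩ := (distLE_sup_of_walk w rfl rfl).exists_walk
  exact hK w' hpq (hw'.trans (by gcongr))

lemma CoarseBonds.familyAsdimLT_image (h : 𝒯.CoarseBonds) {m : ℕ} {E : T → Set P}
    (hE : ∀ t, ∀ p ∈ E t, 𝒯.node p = t) (hasdim : FamilyAsdimLT 𝒯.copy E m) :
    FamilyAsdimLT 𝒯.contraction (fun t => 𝒯.cls '' E t) m := by
  intro r
  obtain ⟨K, hK⟩ := h.exists_distLE_copy r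
  obtain ⟨D, hD⟩ := hasdim K
  refine ⟨D, fun t => ?_⟩
  exact (hD t).of_parametrization (f := fun p : E t => (p : P)) (g := fun p => 𝒯.cls p)
    (fun p => p.2) (fun a ⟨p, hp, hpa⟩ => ⟨⟨p, hp⟩, hpa⟩)
    (fun p q => hK p q ((hE t p p.2).trans (hE t q q.2).symm)) fun _ _ => 𝒯.distLE_cls

end RootedTreeOfGraphs

/-! ### The asymptotic dimension of a contracted tree of graphs -/

/-- The distance from the set `O`, truncated at `L`. -/
noncomputable def truncDist {V : Type*} (G : SimpleGraph V) (O : Set V) (L : ℕ) (a : V) : ℕ :=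
  sInf {i | i = L ∨ ∃ b ∈ O, DistLE G i a b}

namespace truncDist

variable {V : Type*} {G : SimpleGraph V} {O O' : Set V} {L i : ℕ} {a b : V}

lemma eq_or_exists (G : SimpleGraph V) (O : Set V) (L : ℕ) (a : V) :
    truncDist G O L a = L ∨ ∃ b ∈ O, DistLE G (truncDist G O L a) a b :=
  Nat.sInf_mem (s := {i | i = L ∨ ∃ b ∈ O, DistLE G i a b}) ⟨L, Or.inl rfl⟩

lemma le (G : SimpleGraph V) (O : Set V) (L : ℕ) (a : V) : truncDist G O L a ≤ L :=
  Nat.sInf_le (Or.inl rfl)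

lemma le_of_distLE (hb : b ∈ O) (h : DistLE G i a b) : truncDist G O L a ≤ i :=
  Nat.sInf_le (Or.inr ⟨b, hb, h⟩)

lemma le_add (h : DistLE G i a b) : truncDist G O L a ≤ truncDist G O L b + i := by
  rcases eq_or_exists G O L b with hb | ⟨c, hc, hbc⟩
  · exact (le G O L a).trans (hb.ge.trans (Nat.le_add_right _ _))
  · exact le_of_distLE hc (h.trans hbc (add_comm _ _).le)

lemma anti (hO : O ⊆ O') (L : ℕ) (a : V) : truncDist G O' L a ≤ truncDist G O L a := by
  rcases eq_or_exists G O L a with ha | ⟨c, hc, hac⟩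
  · exact (le G O' L a).trans ha.ge
  · exact le_of_distLE (hO hc) hac

end truncDist

namespace RootedTreeOfGraphs

variable {P T : Type*} {𝒯 : RootedTreeOfGraphs P T} {m n r R d D : ℕ} {a b : 𝒯.Vtx} {t : T}

variable (𝒯) in
/-- The union of the nodes in the first `m + 1` levels below `t`. -/
def levels (t : T) (m : ℕ) : Set 𝒯.Vtx :=
  {a | ∃ p, 𝒯.cls p = a ∧ 𝒯.Below t (𝒯.node p) ∧ 𝒯.depth (𝒯.node p) ≤ 𝒯.depth t + m}

variable (𝒯) in
/-- The vertices with top nodes of depth `d` that are not within distance `r` of vertices with top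
nodes of smaller depth. -/
def isolated (d r : ℕ) : Set 𝒯.Vtx :=
  {a | 𝒯.topDepth a = d ∧ ∀ b, DistLE 𝒯.contraction r a b → d ≤ 𝒯.topDepth b}

lemma hasColoring_isolated
    (h : ∀ t, HasColoring 𝒯.contraction (𝒯.cls '' (𝒯.node ⁻¹' {t})) m r D) (d : ℕ) :
    HasColoring 𝒯.contraction (𝒯.isolated d r) m r D := by
  refine HasColoring.of_separated 𝒯.topNode (fun a ha b hb hab => ?_) fun t => ?_
  · rcases anc_eq_or_exists_mem_joint hab ha.1.ge with ⟨-, hanc⟩ | ⟨q, -, hqd, haq⟩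
    · rwa [anc_eq_self ha.1, anc_eq_self hb.1, eq_comm] at hanc
    · exact absurd hqd (not_lt.2 (ha.2 _ haq))
  · refine (h t).mono ?_ le_rfl le_rfl le_rfl
    rintro a ⟨-, rfl⟩
    obtain ⟨p, hp, hpn⟩ := exists_cls_eq_topNode a
    exact ⟨p, hpn, hp⟩

lemma cls_mem_levels_of_mem_joint {s : T} {q : P} (hq : q ∈ 𝒯.joint s) (hs : 𝒯.Below t s)
    (hd : 𝒯.depth s = 𝒯.depth t + m + 1) : 𝒯.cls q ∈ 𝒯.levels t m := by
  obtain ⟨rfl, hup⟩ := hq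
  obtain ⟨-, hparent, hdepth⟩ := up_spec hup
  exact ⟨𝒯.up q, cls_up q, hparent ▸ hs.parent (by omega), by omega⟩

lemma levels_succ_subset (t : T) (m r : ℕ) : 𝒯.levels t (m + 1) ⊆
    neighborhood 𝒯.contraction r (𝒯.levels t m) ∪ 𝒯.isolated (𝒯.depth t + m + 1) r := by
  rintro _ ⟨p, rfl, hp, hpd⟩
  rcases hpd.lt_or_eq with hlt | hpd
  · exact Or.inl ⟨_, ⟨p, rfl, hp, Nat.lt_succ_iff.1 hlt⟩, .refl _ _ _⟩
  by_cases hup : 𝒯.up p = p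
  · have htop : 𝒯.topNode (𝒯.cls p) = 𝒯.node p := by rw [topNode_cls, top_eq_self hup]
    have htopd : 𝒯.topDepth (𝒯.cls p) = 𝒯.depth t + m + 1 := by rw [topDepth, htop, hpd]; rfl
    by_cases hiso : ∀ b, DistLE 𝒯.contraction r (𝒯.cls p) b → 𝒯.depth t + m + 1 ≤ 𝒯.topDepth b
    · exact Or.inr ⟨htopd, hiso⟩
    · push Not at hiso
      obtain ⟨b, hpb, hb⟩ := hiso
      obtain ⟨q, hq, -, hpq⟩ := (anc_eq_or_exists_mem_joint hpb htopd.ge).resolve_left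
        fun h => absurd h.1 (not_le.2 hb)
      rw [htop, anc_eq_self (hpd.trans (Nat.add_assoc _ _ _).symm)] at hq
      exact Or.inl ⟨_, cls_mem_levels_of_mem_joint hq hp hpd, hpq⟩
  · exact Or.inl ⟨_, cls_mem_levels_of_mem_joint ⟨rfl, hup⟩ hp hpd, .refl _ _ _⟩

lemma familyAsdimLT_levels
    (h : FamilyAsdimLT 𝒯.contraction (fun t => 𝒯.cls '' (𝒯.node ⁻¹' {t})) m) (M : ℕ) :
    FamilyAsdimLT 𝒯.contraction (fun t => 𝒯.levels t M) m := by
  induction M with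
  | zero =>
    refine h.of_subset fun t => ⟨t, ?_⟩
    rintro _ ⟨p, rfl, hp, hd⟩
    exact ⟨p, hp.eq hd, rfl⟩
  | succ M ih =>
    intro r
    obtain ⟨d, hd⟩ := h r
    obtain ⟨D, hD⟩ := ih.of_subset_neighborhood r (fun _ => subset_rfl) (d + 2 * r)
    exact ⟨_, fun t => ((hasColoring_isolated hd _).union (hD t)).mono (levels_succ_subset t M r)
      le_rfl le_rfl le_rfl⟩

variable (𝒯) in
/-- The number of levels between two successive cuts of the contracted graph. It is so large that
the sets of vertices at distance at most `2 * R` from two cuts are disjoint. -/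
def bandDepth (R : ℕ) : ℕ := 𝒯.size * (2 * R) + 1

variable (𝒯) in
/-- The distance from the vertices above the `j`-th cut, truncated at `2 * R`. -/
noncomputable def distAbove (R j : ℕ) : 𝒯.Vtx → ℕ :=
  truncDist 𝒯.contraction {b | 𝒯.topDepth b < j * 𝒯.bandDepth R} (2 * R)

variable (𝒯) in
/-- The number of the band that contains `a`. The bands are separated by the sets of vertices at
distance `R` from the vertices above the cuts. -/
noncomputable def band (R : ℕ) (a : 𝒯.Vtx) : ℕ := sInf {j | 𝒯.distAbove R (j + 1) a < R}

variable (𝒯) in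
/-- The node at the `j`-th cut below which `a` lies. -/
noncomputable def cutNode (R j : ℕ) (a : 𝒯.Vtx) : T := 𝒯.anc (j * 𝒯.bandDepth R) (𝒯.topNode a)

variable (𝒯) in
/-- The part of a band below one node that contains `a`. -/
noncomputable def bandPiece (R : ℕ) (a : 𝒯.Vtx) : ℕ × T :=
  (𝒯.band R a, 𝒯.cutNode R (𝒯.band R a) a)

variable (𝒯) in
/-- A lower bound for the distance of `a` from the boundaries of the bands. -/
noncomputable def bandHeight (R : ℕ) (a : 𝒯.Vtx) : ℕ :=
  sInf (Set.range fun j => Nat.dist (𝒯.distAbove R j a) R)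

lemma distAbove_le (R j : ℕ) (a : 𝒯.Vtx) : 𝒯.distAbove R j a ≤ 2 * R := truncDist.le _ _ _ _

lemma distAbove_le_add (R j : ℕ) (h : DistLE 𝒯.contraction r a b) :
    𝒯.distAbove R j a ≤ 𝒯.distAbove R j b + r := truncDist.le_add h

lemma distAbove_anti (R : ℕ) (a : 𝒯.Vtx) : Antitone fun j => 𝒯.distAbove R j a :=
  fun _ _ hij => truncDist.anti
    (fun _ hb => lt_of_lt_of_le hb (Nat.mul_le_mul_right (𝒯.bandDepth R) hij)) _ a

lemma distAbove_zero (R : ℕ) (a : 𝒯.Vtx) : 𝒯.distAbove R 0 a = 2 * R := by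
  refine (truncDist.eq_or_exists _ _ _ _).resolve_right ?_
  rintro ⟨c, hc, -⟩
  simp at hc

lemma distAbove_le_of_lt {j : ℕ} (hb : 𝒯.topDepth b < j * 𝒯.bandDepth R)
    (hab : DistLE 𝒯.contraction r a b) : 𝒯.distAbove R j a ≤ r := truncDist.le_of_distLE hb hab

lemma le_topDepth_of_distAbove_pos {j : ℕ} (h : 0 < 𝒯.distAbove R j a) :
    j * 𝒯.bandDepth R ≤ 𝒯.topDepth a := by
  by_contra hlt
  exact absurd (distAbove_le_of_lt (not_le.1 hlt) (.refl _ 0 a)) (not_le.2 h)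

lemma exists_of_distAbove_lt {j : ℕ} (h : 𝒯.distAbove R j a < 2 * R) :
    ∃ b, 𝒯.topDepth b < j * 𝒯.bandDepth R ∧ DistLE 𝒯.contraction (𝒯.distAbove R j a) a b :=
  (truncDist.eq_or_exists _ _ _ _).resolve_left h.ne

lemma distAbove_eq_of_lt {i j : ℕ} (hij : i < j) (h : 0 < 𝒯.distAbove R j a) :
    𝒯.distAbove R i a = 2 * R := by
  by_contra hne
  obtain ⟨b, hb, hab⟩ := exists_of_distAbove_lt (lt_of_le_of_ne (distAbove_le R i a) hne)
  have hdepth : 𝒯.topDepth a ≤ 𝒯.topDepth b + 𝒯.size * (2 * R) :=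
    (hab.mono (distAbove_le R i a)).le_add_mul fun _ _ => topDepth_le_of_adj
  have hbelow : (i + 1) * 𝒯.bandDepth R ≤ 𝒯.topDepth a :=
    le_topDepth_of_distAbove_pos (h.trans_le (distAbove_anti R a hij))
  rw [add_mul, one_mul] at hbelow
  rw [bandDepth] at *
  omega

lemma cutNode_eq_of_lt_distAbove {j : ℕ} (hab : DistLE 𝒯.contraction r a b)
    (h : r < 𝒯.distAbove R j a) :
    j * 𝒯.bandDepth R ≤ 𝒯.topDepth b ∧ 𝒯.cutNode R j b = 𝒯.cutNode R j a := by
  refine (anc_eq_or_exists_mem_joint hab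
    (le_topDepth_of_distAbove_pos ((Nat.zero_le _).trans_lt h))).resolve_right ?_
  rintro ⟨q, -, hq, haq⟩
  exact absurd (distAbove_le_of_lt hq haq) (not_le.2 h)

lemma mem_neighborhood_joint {j : ℕ} (hpos : 0 < 𝒯.distAbove R j a)
    (hlt : 𝒯.distAbove R j a < 2 * R) :
    a ∈ neighborhood 𝒯.contraction (2 * R) (𝒯.cls '' 𝒯.joint (𝒯.cutNode R j a)) := by
  obtain ⟨b, hb, hab⟩ := exists_of_distAbove_lt hlt
  obtain ⟨q, hq, -, haq⟩ := (anc_eq_or_exists_mem_joint hab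
    (le_topDepth_of_distAbove_pos hpos)).resolve_left fun h => absurd h.1 (not_le.2 hb)
  exact ⟨_, ⟨q, hq, rfl⟩, haq.mono hlt.le⟩

lemma distAbove_succ_band_lt (hR : 0 < R) (a : 𝒯.Vtx) : 𝒯.distAbove R (𝒯.band R a + 1) a < R := by
  refine Nat.sInf_mem (s := {j | 𝒯.distAbove R (j + 1) a < R}) ⟨𝒯.topDepth a, ?_⟩
  by_contra hle
  have hdepth := le_topDepth_of_distAbove_pos (hR.trans_le (not_lt.1 hle))
  have hmul : 𝒯.topDepth a + 1 ≤ (𝒯.topDepth a + 1) * 𝒯.bandDepth R :=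
    Nat.le_mul_of_pos_right _ (Nat.succ_pos _)
  omega

lemma le_distAbove_band (R : ℕ) (a : 𝒯.Vtx) : R ≤ 𝒯.distAbove R (𝒯.band R a) a := by
  cases hband : 𝒯.band R a with
  | zero => rw [distAbove_zero]; omega
  | succ j =>
    refine not_lt.1 (Nat.notMem_of_lt_sInf (s := {j | 𝒯.distAbove R (j + 1) a < R}) ?_)
    exact (Nat.lt_succ_self j).trans_eq hband.symm

lemma bandHeight_le (R j : ℕ) (a : 𝒯.Vtx) : 𝒯.bandHeight R a ≤ Nat.dist (𝒯.distAbove R j a) R :=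
  Nat.sInf_le ⟨j, rfl⟩

lemma exists_dist_eq_bandHeight (R : ℕ) (a : 𝒯.Vtx) :
    ∃ j, Nat.dist (𝒯.distAbove R j a) R = 𝒯.bandHeight R a :=
  Nat.sInf_mem (Set.range_nonempty fun j => Nat.dist (𝒯.distAbove R j a) R)

lemma bandHeight_le_add (R : ℕ) (hab : DistLE 𝒯.contraction r a b) :
    𝒯.bandHeight R a ≤ 𝒯.bandHeight R b + r := by
  obtain ⟨j, hj⟩ := exists_dist_eq_bandHeight R b
  have hle := bandHeight_le R j a
  have hab' := distAbove_le_add R j hab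
  have hba := distAbove_le_add R j hab.symm
  rw [Nat.dist] at hj hle
  omega

lemma bandHeight_le_of_band_lt (hR : 0 < R) (hab : DistLE 𝒯.contraction r a b)
    (hlt : 𝒯.band R a < 𝒯.band R b) : 𝒯.bandHeight R a ≤ r := by
  have hle := bandHeight_le R (𝒯.band R a + 1) a
  have hba := distAbove_le_add R (𝒯.band R a + 1) hab.symm
  have ha := distAbove_succ_band_lt hR a
  have hb : R ≤ 𝒯.distAbove R (𝒯.band R a + 1) b :=
    (le_distAbove_band R b).trans (distAbove_anti R b hlt)
  rw [Nat.dist] at hle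
  omega

lemma bandHeight_le_of_lt_band (hR : 0 < R) (hab : DistLE 𝒯.contraction r a b)
    (hlt : 𝒯.band R b < 𝒯.band R a) : 𝒯.bandHeight R a ≤ r := by
  have hle := bandHeight_le R (𝒯.band R a) a
  have hab' := distAbove_le_add R (𝒯.band R a) hab
  have ha := le_distAbove_band R a
  have hb : 𝒯.distAbove R (𝒯.band R a) b < R :=
    (distAbove_anti R b hlt).trans_lt (distAbove_succ_band_lt hR b)
  rw [Nat.dist] at hle
  omega

lemma bandHeight_le_of_bandPiece_ne (hr : r < R) (hab : DistLE 𝒯.contraction r a b)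
    (hne : 𝒯.bandPiece R a ≠ 𝒯.bandPiece R b) : 𝒯.bandHeight R a ≤ r := by
  have hR : 0 < R := (Nat.zero_le _).trans_lt hr
  rcases lt_trichotomy (𝒯.band R a) (𝒯.band R b) with hlt | heq | hlt
  · exact bandHeight_le_of_band_lt hR hab hlt
  · refine absurd (Prod.ext heq ?_) hne
    have hcut := (cutNode_eq_of_lt_distAbove hab (hr.trans_le (le_distAbove_band R a))).2
    simp only [bandPiece, ← heq, hcut]
  · exact bandHeight_le_of_lt_band hR hab hlt

lemma le_of_dist_distAbove_le {i j w : ℕ} (hR : w + r < R) (hab : DistLE 𝒯.contraction r a b)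
    (ha : Nat.dist (𝒯.distAbove R i a) R ≤ w) (hb : Nat.dist (𝒯.distAbove R j b) R ≤ w) :
    j ≤ i := by
  by_contra hij
  rw [Nat.dist] at ha hb
  have hba := distAbove_le_add R j hab.symm
  have hai := distAbove_eq_of_lt (not_le.1 hij) (by omega : 0 < 𝒯.distAbove R j a)
  omega

lemma hasColoring_bandHeight_le {w : ℕ} (hR : w + r < R)
    (h : ∀ t, HasColoring 𝒯.contraction
      (neighborhood 𝒯.contraction (2 * R) (𝒯.cls '' 𝒯.joint t)) n r d) :
    HasColoring 𝒯.contraction {a | 𝒯.bandHeight R a ≤ w} n r d := by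
  choose cut hcut using exists_dist_eq_bandHeight (𝒯 := 𝒯) R
  have hnear : ∀ a, 𝒯.bandHeight R a ≤ w → Nat.dist (𝒯.distAbove R (cut a) a) R ≤ w :=
    fun a ha => (hcut a).trans_le ha
  refine HasColoring.of_separated (fun a => (cut a, 𝒯.cutNode R (cut a) a)) ?_ ?_
  · intro a ha b hb hab
    have heq : cut a = cut b :=
      le_antisymm (le_of_dist_distAbove_le hR hab.symm (hnear b hb) (hnear a ha))
        (le_of_dist_distAbove_le hR hab (hnear a ha) (hnear b hb))
    have hdist := hnear a ha
    rw [Nat.dist] at hdist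
    have hnode := (cutNode_eq_of_lt_distAbove hab (by omega : r < 𝒯.distAbove R (cut a) a)).2
    simp only [← heq, hnode]
  · rintro ⟨j, t⟩
    refine (h t).mono ?_ le_rfl le_rfl le_rfl
    rintro a ⟨ha, hlabel⟩
    obtain ⟨rfl, rfl⟩ := Prod.ext_iff.1 hlabel
    have hdist := hnear a ha
    rw [Nat.dist] at hdist
    exact mem_neighborhood_joint (by omega) (by omega)

lemma mem_neighborhood_levels (hR : 0 < R) (a : 𝒯.Vtx) : a ∈ neighborhood 𝒯.contraction (2 * R)
    (𝒯.levels (𝒯.cutNode R (𝒯.band R a) a) (𝒯.bandDepth R)) := by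
  have hle := le_distAbove_band R a
  have hlt := distAbove_succ_band_lt hR a
  obtain ⟨b, hb, hab⟩ := exists_of_distAbove_lt (hlt.trans_le (by omega))
  obtain ⟨hdepth, hcut⟩ := cutNode_eq_of_lt_distAbove hab (hlt.trans_le hle)
  obtain ⟨p, rfl, hpn⟩ := exists_cls_eq_topNode b
  refine ⟨_, ⟨p, rfl, ?_, ?_⟩, hab.mono (by omega)⟩
  · rw [← hcut, cutNode, hpn]
    exact below_anc hdepth
  · rw [cutNode, depth_anc (le_topDepth_of_distAbove_pos (hR.trans_le hle)), hpn,
      ← Nat.succ_mul]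
    exact hb.le

/- The pieces of the bands are glued along their boundaries, which are neighbourhoods of the sets of
vertices that nodes share with their parents. -/
theorem CoarseBonds.asdimLE_contraction [Nonempty P] (hbond : 𝒯.CoarseBonds)
    (hnode : FamilyAsdimLT 𝒯.copy (fun t => 𝒯.node ⁻¹' {t}) (n + 1))
    (hjoint : FamilyAsdimLT 𝒯.copy 𝒯.joint n) :
    letI := graphMetric 𝒯.contraction; AsdimLE 𝒯.Vtx n := by
  have : Nonempty 𝒯.Vtx := ⟨𝒯.cls (Classical.arbitrary P)⟩
  refine asdimLE_of_forall_hasLebesgueCover fun k hk => ?_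
  obtain ⟨R, hR⟩ : ∃ R, 3 * k * (n + 1) + k + 2 * k < R := ⟨_, Nat.lt_succ_self _⟩
  have hnodes := hbond.familyAsdimLT_image (fun _ _ hp => hp) hnode
  have hjoints := hbond.familyAsdimLT_image (fun _ _ hp => hp.1) hjoint
  obtain ⟨d, hd⟩ := hjoints.of_subset_neighborhood (2 * R) (fun _ => subset_rfl) (2 * k)
  refine hasLebesgueCover_of_partition hk (𝒯.bandPiece R) (𝒯.bandHeight R)
    (fun _ _ => bandHeight_le_add R) (fun _ _ => bandHeight_le_of_bandPiece_ne (by omega))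
    (hasColoring_bandHeight_le hR hd) ?_
  have hlevels := (familyAsdimLT_levels hnodes (𝒯.bandDepth R)).of_subset (ι := ℕ × T)
    fun i => ⟨i.2, subset_rfl⟩
  refine hlevels.of_subset_neighborhood (2 * R) ?_
  rintro ⟨j, t⟩ a ha
  obtain ⟨rfl, rfl⟩ := Prod.ext_iff.1 ha
  exact mem_neighborhood_levels (by omega) a

end RootedTreeOfGraphs

/-! ### Graphs with group actions -/

lemma exists_uniform_bound_of_finite {α : Type*} {F : Set α} (hF : F.Finite) {Q : α → ℕ → Prop}
    (hQ : ∀ a, Monotone (Q a)) (h : ∀ a ∈ F, ∃ K, Q a K) : ∃ K, ∀ a ∈ F, Q a K := by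
  choose! f hf using h
  obtain ⟨K, hK⟩ := (hF.image f).bddAbove
  exact ⟨K, fun a ha => hQ a (hK ⟨a, ha, rfl⟩) (hf a ha)⟩

section DistPreserving

variable {V V' : Type*} {G : SimpleGraph V} {G' : SimpleGraph V'} {f : V → V'} {m r D : ℕ}

/-- The map `f` preserves the graph distance. -/
def DistPreserving (G : SimpleGraph V) (G' : SimpleGraph V') (f : V → V') : Prop :=
  ∀ r x y, DistLE G' r (f x) (f y) ↔ DistLE G r x y

lemma DistPreserving.of_iso (e : G ≃g G') : DistPreserving G G' e := fun r x y =>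
  ⟨fun h => by simpa using h.map e.symm fun _ _ hab => .of_adj (e.symm.map_adj_iff.2 hab),
    fun h => h.map e fun _ _ hab => .of_adj (e.map_adj_iff.2 hab)⟩

lemma DistPreserving.hasColoring_of_mapsTo {A : Set V} {A' : Set V'} (hf : DistPreserving G G' f)
    (h : HasColoring G' A' m r D) (hA : Set.MapsTo f A A') : HasColoring G A m r D :=
  h.transfer f hA (fun x _ y _ => (hf r x y).2) fun x _ y _ => (hf D x y).1

lemma DistPreserving.hasColoring_of_subset_image {A : Set V} {B : Set V'}
    (hf : DistPreserving G G' f) (h : HasColoring G A m r D) (hB : B ⊆ f '' A) :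
    HasColoring G' B m r D :=
  h.of_parametrization (f := fun x : A => (x : V)) (g := fun x => f x) (fun x => x.2)
    (fun y hy => by obtain ⟨x, hx, rfl⟩ := hB hy; exact ⟨⟨x, hx⟩, rfl⟩)
    (fun x y => (hf r x y).1) fun x y => (hf D x y).2

lemma DistPreserving.asdimLT_of_mapsTo {A : Set V} {A' : Set V'} (hf : DistPreserving G G' f)
    (h : AsdimLT G' A' m) (hA : Set.MapsTo f A A') : AsdimLT G A m := by
  intro r
  obtain ⟨D, hD⟩ := h r
  exact ⟨D, hf.hasColoring_of_mapsTo hD hA⟩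

lemma FamilyAsdimLT.of_distPreserving {ι ι' : Type*} {E : ι → Set V} {F : ι' → Set V'}
    (h : FamilyAsdimLT G E m) (hF : ∀ j, (F j).Nonempty →
      ∃ i, ∃ f : V → V', DistPreserving G G' f ∧ F j ⊆ f '' E i) : FamilyAsdimLT G' F m := by
  intro r
  obtain ⟨D, hD⟩ := h r
  refine ⟨D, fun j => ?_⟩
  rcases (F j).eq_empty_or_nonempty with hj | hj
  · rw [hj]
    exact .empty G' m r D
  · obtain ⟨i, f, hf, hFE⟩ := hF j hj
    exact hf.hasColoring_of_subset_image (hD i) hFE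

end DistPreserving

section Actions

variable {V V' I I' Γ Γ' : Type*} [Group Γ] [MulAction Γ V] [Group Γ'] [MulAction Γ' V']
  {G : SimpleGraph V} {G' : SimpleGraph V'} {S : I → Set V} {S' : I' → Set V'}
  {φ : ∀ k l, S k ≃ S' l} {R : I → I' → Prop}

lemma ActsOnGraph.distLE_smul (h : ActsOnGraph Γ G) (γ : Γ) {r : ℕ} {x y : V}
    (hxy : DistLE G r x y) : DistLE G r (γ • x) (γ • y) :=
  hxy.map (γ • ·) fun a b hab => .of_adj ((h γ a b).2 hab)

lemma ActsOnGraph.distPreserving_smul (h : ActsOnGraph Γ G) (γ : Γ) :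
    DistPreserving G G (γ • ·) := fun r x y =>
  ⟨fun hxy => by simpa using h.distLE_smul γ⁻¹ hxy, h.distLE_smul γ⟩

lemma ActsQuasiTransitively.exists_finite_reps (h : ActsQuasiTransitively Γ G) :
    ∃ X : Set V, X.Finite ∧ ∀ x : V, ∃ γ : Γ, γ • x ∈ X := by
  have := h.2
  refine ⟨Set.range fun q : MulAction.orbitRel.Quotient Γ V => Quotient.out q,
    Set.finite_range _, fun x => ?_⟩
  have hrel : (MulAction.orbitRel Γ V).r (Quotient.out (Quotient.mk _ x)) x := Quotient.mk_out x
  obtain ⟨γ, hγ⟩ := hrel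
  exact ⟨γ, Quotient.mk _ x, hγ.symm⟩

/-- The maps `φ k l` with `R k l` are bornologous, with the same control function. -/
def UniformlyBornologous (G : SimpleGraph V) (G' : SimpleGraph V') (φ : ∀ k l, S k ≃ S' l)
    (R : I → I' → Prop) : Prop :=
  ∀ r, ∃ K, ∀ k l, R k l → ∀ x z : S k, DistLE G r x z → DistLE G' K (φ k l x) (φ k l z)

lemma ConsistentBonds.exists_distLE (h : ConsistentBonds Γ' φ R) (hconn : G'.Connected)
    (hact : ActsOnGraph Γ' G') {k : I} (x z : S k) :
    ∃ K, ∀ l, R k l → DistLE G' K (φ k l x) (φ k l z) := by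
  by_cases hex : ∃ l, R k l
  · obtain ⟨l₀, hl₀⟩ := hex
    obtain ⟨K, hK⟩ := DistLE.exists_of_connected hconn (φ k l₀ x : V') (φ k l₀ z)
    refine ⟨K, fun l hl => ?_⟩
    obtain ⟨γ, hγ⟩ := h k l l₀ hl hl₀
    rw [hγ, hγ]
    exact hact.distLE_smul γ hK
  · exact ⟨0, fun l hl => absurd ⟨l, hl⟩ hex⟩

lemma finite_setOf_pairs_distLE (hfin : ∀ x, (G.neighborSet x).Finite)
    (hS : ∀ x, {k | x ∈ S k}.Finite) {X : Set V} (hX : X.Finite) (r : ℕ) :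
    {p : Σ k, S k × S k | (p.2.1 : V) ∈ X ∧ DistLE G r p.2.1 p.2.2}.Finite := by
  have hfinite : (⋃ x ∈ X, {k | x ∈ S k} ×ˢ ({x} ×ˢ {z | DistLE G r x z})).Finite :=
    hX.biUnion fun x _ =>
      (hS x).prod ((Set.finite_singleton x).prod (DistLE.finite_setOf hfin r x))
  refine Set.Finite.of_finite_image (f := fun p => (p.1, (p.2.1 : V), (p.2.2 : V)))
    (hfinite.subset ?_) ?_
  · rintro _ ⟨⟨k, x, z⟩, ⟨hx, hxz⟩, rfl⟩
    exact Set.mem_biUnion hx ⟨x.2, rfl, hxz⟩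
  · rintro ⟨k, x, z⟩ - ⟨k', x', z'⟩ - heq
    simp only [Prod.mk.injEq] at heq
    obtain ⟨rfl, hx, hz⟩ := heq
    rw [Subtype.ext hx, Subtype.ext hz]

/- Up to the actions of both groups there are only finitely many pairs of vertices at distance at
most `r` in a common set `S k`, and only one map out of each `S k`. -/
lemma uniformlyBornologous_of_respectsElement (hfin : ∀ x, (G.neighborSet x).Finite)
    (hconn : G'.Connected) (hact : ActsQuasiTransitively Γ G) (hact' : ActsOnGraph Γ' G')
    (hS : ∀ x, {k | x ∈ S k}.Finite) (hresp : ∀ γ : Γ, RespectsElement Γ' φ R γ)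
    (hcons : ConsistentBonds Γ' φ R) : UniformlyBornologous G G' φ R := by
  intro r
  obtain ⟨X, hX, hXrep⟩ := hact.exists_finite_reps
  obtain ⟨K, hK⟩ := exists_uniform_bound_of_finite (finite_setOf_pairs_distLE hfin hS hX r)
    (Q := fun p K => ∀ l, R p.1 l → DistLE G' K (φ p.1 l p.2.1) (φ p.1 l p.2.2))
    (fun _ _ _ hle hQ l hl => (hQ l hl).mono hle)
    fun p _ => hcons.exists_distLE hconn hact' p.2.1 p.2.2
  refine ⟨K, fun k l hkl x z hxz => ?_⟩
  obtain ⟨γ, hγ⟩ := hXrep x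
  obtain ⟨σ, hσ⟩ := hresp γ
  obtain ⟨l', hkl', hσl', τ, -, hτ⟩ := hσ k
  obtain ⟨hx, hφx⟩ := hτ x
  obtain ⟨hz, hφz⟩ := hτ z
  obtain ⟨ρ, hρ⟩ := hcons k l l' hkl hkl'
  have hrep : DistLE G' K (φ (σ k) l' ⟨γ • (x : V), hx⟩) (φ (σ k) l' ⟨γ • (z : V), hz⟩) :=
    hK ⟨σ k, ⟨_, hx⟩, ⟨_, hz⟩⟩ ⟨hγ, hact.1.distLE_smul γ hxz⟩ l' hσl'
  rw [hρ, hρ, hφx, hφz]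
  exact hact'.distLE_smul ρ (hact'.distLE_smul τ hrep)

lemma UniformlyBornologous.asdimLT (h : UniformlyBornologous G G' φ R)
    (h' : UniformlyBornologous G' G (fun l k => (φ k l).symm) fun l k => R k l) {k : I} {l : I'}
    (hkl : R k l) {m : ℕ} (hasdim : AsdimLT G' (S' l) m) : AsdimLT G (S k) m := by
  intro r
  obtain ⟨K, hK⟩ := h r
  obtain ⟨D', hD'⟩ := hasdim K
  obtain ⟨D, hD⟩ := h' D'
  refine ⟨D, hD'.of_parametrization (f := fun x => (φ k l x : V')) (g := fun x : S k => (x : V))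
    (fun x => (φ k l x).2) (fun x hx => ⟨⟨x, hx⟩, rfl⟩) (hK k l hkl) fun x z hxz => ?_⟩
  simpa using hD l k hkl _ _ hxz

lemma familyAsdimLT_of_respectsElement (hact : ActsQuasiTransitively Γ G)
    (hS : ∀ x, {k | x ∈ S k}.Finite) (hresp : ∀ γ : Γ, RespectsElement Γ' φ R γ) {m : ℕ}
    (hasdim : ∀ k, AsdimLT G (S k) m) : FamilyAsdimLT G S m := by
  intro r
  obtain ⟨X, hX, hXrep⟩ := hact.exists_finite_reps
  obtain ⟨D, hD⟩ := exists_uniform_bound_of_finite (hX.biUnion fun x _ => hS x)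
    (Q := fun k D => HasColoring G (S k) m r D)
    (fun _ _ _ hle h => h.mono subset_rfl le_rfl le_rfl hle) fun k _ => hasdim k r
  refine ⟨D, fun k => ?_⟩
  rcases (S k).eq_empty_or_nonempty with hk | ⟨x, hx⟩
  · rw [hk]
    exact .empty G m r D
  · obtain ⟨γ, hγ⟩ := hXrep x
    obtain ⟨σ, hσ⟩ := hresp γ
    obtain ⟨l, -, -, τ, -, hτ⟩ := hσ k
    have hmaps : Set.MapsTo (γ • ·) (S k) (S (σ k)) := fun y hy => (hτ ⟨y, hy⟩).1
    exact (hact.1.distPreserving_smul γ).hasColoring_of_mapsTo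
      (hD (σ k) (Set.mem_biUnion hγ (hmaps hx))) hmaps

end Actions

/-! ### Tree amalgamations as rooted trees of graphs -/

/-- A rooting of the tree `Tr`: every edge joins a node to its parent. -/
structure Rooting {T : Type*} (Tr : SimpleGraph T) where
  /-- the distance from the root -/
  depth : T → ℕ
  /-- the parent of a node; the root is its own parent -/
  parent : T → T
  depth_parent : ∀ t, depth (parent t) = depth t - 1
  adj : ∀ s t, Tr.Adj s t →
    (t = parent s ∧ depth s = depth t + 1) ∨ (s = parent t ∧ depth t = depth s + 1)

lemma exists_parent_of_isTree {T : Type*} {Tr : SimpleGraph T} (hT : Tr.IsTree) (o t : T) :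
    ∃ s, Tr.dist o s = Tr.dist o t - 1 ∧
      ∀ s', Tr.Adj t s' → Tr.dist o t = Tr.dist o s' + 1 → s' = s := by
  obtain ⟨p, hp, hpt⟩ := hT.connected.exists_path_of_dist t o
  cases p with
  | nil => exact ⟨o, by simp, fun s' _ h => by simp at h⟩
  | @cons _ s _ hts p =>
    rw [SimpleGraph.Walk.length_cons, SimpleGraph.dist_comm] at hpt
    refine ⟨s, ?_, fun s' hts' hs' => ?_⟩
    · have hle := SimpleGraph.dist_le p
      have hdiff := hT.dist_eq_dist_add_one_of_adj o hts
      rw [SimpleGraph.dist_comm] at hle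
      omega
    · obtain ⟨p', -, hp's'⟩ := hT.connected.exists_path_of_dist s' o
      have hp' : (SimpleGraph.Walk.cons hts' p').IsPath := by
        refine SimpleGraph.Walk.isPath_of_length_eq_dist _ ?_
        rw [SimpleGraph.Walk.length_cons, hp's', SimpleGraph.dist_comm, ← hs',
          SimpleGraph.dist_comm]
      have heq := congrArg Subtype.val
        ((hT.isAcyclic.subsingleton_path t o).elim ⟨_, hp'⟩ ⟨_, hp⟩)
      simpa using congrArg SimpleGraph.Walk.snd heq

lemma nonempty_rooting_of_isTree {T : Type*} {Tr : SimpleGraph T} (hT : Tr.IsTree) :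
    Nonempty (Rooting Tr) := by
  obtain ⟨o⟩ := hT.connected.nonempty
  choose parent hdist hparent using exists_parent_of_isTree hT o
  refine ⟨⟨Tr.dist o, parent, hdist, fun s t hst => ?_⟩⟩
  rcases hT.dist_eq_dist_add_one_of_adj o hst with h | h
  · exact Or.inl ⟨hparent s t hst h, h⟩
  · exact Or.inr ⟨hparent t s hst.symm h, h⟩

namespace AmalgamData

section RootedTree

variable {V₁ V₂ I₁ I₂ W₁ W₂ : Type*} {D : AmalgamData V₁ V₂ I₁ I₂ W₁ W₂}
  {G₁ : SimpleGraph V₁} {G₂ : SimpleGraph V₂} {u : W₁} {w : W₂} {x : V₁} {y : V₂}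
  {p q q' : (W₁ × V₁) ⊕ (W₂ × V₂)}

lemma Bond.left_mem (h : D.Bond u x w y) : x ∈ D.S₁ (D.lab₁ u w) := h.2.1

lemma Bond.right_mem (h : D.Bond u x w y) : y ∈ D.S₂ (D.lab₂ w u) := by
  obtain ⟨-, hx, rfl⟩ := h
  exact Subtype.coe_prop _

lemma node_eq_of_copies_adj (h : (D.copies G₁ G₂).Adj p q) : node p = node q := by
  rcases p with p | p <;> rcases q with q | q
  · exact congrArg Sum.inl h.1
  · exact h.elim
  · exact h.elim
  · exact congrArg Sum.inr h.1

lemma tree_adj_of_bonds_adj (h : D.bonds.Adj p q) : D.tree.Adj (node p) (node q) := by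
  rcases p with p | p <;> rcases q with q | q
  · exact h.elim
  · exact h.1
  · exact h.1.symm
  · exact h.elim

lemma eq_of_bonds_adj (h : D.bonds.Adj p q) (h' : D.bonds.Adj p q') (hn : node q = node q') :
    q = q' := by
  rcases p with ⟨u, x⟩ | ⟨w, y⟩ <;> rcases q with ⟨v, a⟩ | ⟨v, a⟩ <;>
    rcases q' with ⟨v', a'⟩ | ⟨v', a'⟩
  all_goals first | exact h.elim | exact h'.elim | skip
  · obtain rfl : v = v' := Sum.inr_injective hn
    obtain ⟨-, _, ha⟩ := h
    obtain ⟨-, _, ha'⟩ := h'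
    rw [show a = a' from ha.symm.trans ha']
  · obtain rfl : v = v' := Sum.inl_injective hn
    obtain ⟨-, _, ha⟩ := h
    obtain ⟨-, _, ha'⟩ := h'
    have heq := congrArg Subtype.val ((D.φ _ _).injective (Subtype.ext (ha.trans ha'.symm)))
    rw [show a = a' from heq]

/-- The tree amalgamation as a rooted tree of graphs. -/
noncomputable abbrev rooted (D : AmalgamData V₁ V₂ I₁ I₂ W₁ W₂) (G₁ : SimpleGraph V₁)
    (G₂ : SimpleGraph V₂) (h : D.FiniteIdentification) :
    RootedTreeOfGraphs ((W₁ × V₁) ⊕ (W₂ × V₂)) (W₁ ⊕ W₂) where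
  copy := D.copies G₁ G₂
  bond := D.bonds
  node := node
  depth := (nonempty_rooting_of_isTree D.isTree).some.depth
  parent := (nonempty_rooting_of_isTree D.isTree).some.parent
  depth_parent := (nonempty_rooting_of_isTree D.isTree).some.depth_parent
  copy_adj _ _ := node_eq_of_copies_adj
  bond_adj _ _ hpq :=
    (nonempty_rooting_of_isTree D.isTree).some.adj _ _ (tree_adj_of_bonds_adj hpq)
  bond_unique _ _ _ := eq_of_bonds_adj
  size := h.choose
  encard_le := h.choose_spec

lemma distPreserving_inl (D : AmalgamData V₁ V₂ I₁ I₂ W₁ W₂) (G₁ : SimpleGraph V₁)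
    (G₂ : SimpleGraph V₂) (u : W₁) :
    DistPreserving G₁ (D.copies G₁ G₂) fun x => Sum.inl (u, x) := by
  refine fun r x y => ⟨fun h => ?_,
    fun h => h.map (fun x => Sum.inl (u, x)) fun a b hab => .of_adj ⟨rfl, hab⟩⟩
  refine (h.mem_and_map_of_closed (S := Set.range fun x => Sum.inl (u, x))
    (Sum.elim Prod.snd fun _ => x) ?_ ⟨x, rfl⟩).2
  rintro _ ⟨a, rfl⟩ (⟨v, b⟩ | q) hab
  · exact ⟨⟨b, congrArg Sum.inl (Prod.ext hab.1 rfl)⟩, .of_adj hab.2⟩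
  · exact hab.elim

lemma distPreserving_inr (D : AmalgamData V₁ V₂ I₁ I₂ W₁ W₂) (G₁ : SimpleGraph V₁)
    (G₂ : SimpleGraph V₂) (w : W₂) :
    DistPreserving G₂ (D.copies G₁ G₂) fun y => Sum.inr (w, y) := by
  refine fun r x y => ⟨fun h => ?_,
    fun h => h.map (fun y => Sum.inr (w, y)) fun a b hab => .of_adj ⟨rfl, hab⟩⟩
  refine (h.mem_and_map_of_closed (S := Set.range fun y => Sum.inr (w, y))
    (Sum.elim (fun _ => x) Prod.snd) ?_ ⟨x, rfl⟩).2
  rintro _ ⟨a, rfl⟩ (q | ⟨v, b⟩) hab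
  · exact hab.elim
  · exact ⟨⟨b, congrArg Sum.inr (Prod.ext hab.1 rfl)⟩, .of_adj hab.2⟩

lemma FiniteIdentification.finite_setOf_bonds_adj (h : D.FiniteIdentification)
    (p : (W₁ × V₁) ⊕ (W₂ × V₂)) : {t | ∃ q, node q = t ∧ D.bonds.Adj p q}.Finite := by
  obtain ⟨N, hN⟩ := h
  refine (Set.finite_of_encard_le_coe (hN (D.proj p))).subset ?_
  rintro t ⟨q, hqt, hpq⟩
  exact ⟨q, hqt, (SimpleGraph.ConnectedComponent.sound hpq.reachable).symm⟩

lemma FiniteIdentification.finite_setOf_mem₁ (h : D.FiniteIdentification) (u : W₁) (x : V₁) :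
    {k | x ∈ D.S₁ k}.Finite := by
  choose f hf using fun k => (D.lab₁_unique u k).exists
  refine Set.Finite.of_finite_image (f := fun k => (Sum.inr (f k) : W₁ ⊕ W₂))
    ((h.finite_setOf_bonds_adj (Sum.inl (u, x))).subset ?_) fun k _ k' _ hkk' => ?_
  · rintro _ ⟨k, hk, rfl⟩
    have hx : x ∈ D.S₁ (D.lab₁ u (f k)) := (hf k).2.symm ▸ hk
    exact ⟨Sum.inr (f k, D.φ _ (D.lab₂ (f k) u) ⟨x, hx⟩), rfl, (hf k).1, hx, rfl⟩
  · rw [← (hf k).2, ← (hf k').2, Sum.inr_injective hkk']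

lemma FiniteIdentification.finite_setOf_mem₂ (h : D.FiniteIdentification) (w : W₂) (y : V₂) :
    {l | y ∈ D.S₂ l}.Finite := by
  choose f hf using fun l => (D.lab₂_unique w l).exists
  refine Set.Finite.of_finite_image (f := fun l => (Sum.inl (f l) : W₁ ⊕ W₂))
    ((h.finite_setOf_bonds_adj (Sum.inr (w, y))).subset ?_) fun l _ l' _ hll' => ?_
  · rintro _ ⟨l, hl, rfl⟩
    have hy : y ∈ D.S₂ (D.lab₂ w (f l)) := (hf l).2.symm ▸ hl
    exact ⟨Sum.inl (f l, (D.φ (D.lab₁ (f l) w) _).symm ⟨y, hy⟩), rfl, (hf l).1,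
      Subtype.coe_prop _, by simp⟩
  · rw [← (hf l).2, ← (hf l').2, Sum.inl_injective hll']

end RootedTree

end AmalgamData

/-! ### Adhesion sets of tree amalgamations -/

namespace RootedTreeOfGraphs

lemma CoarseBonds.asdimLT_of_image {P T V : Type*} {𝒯 : RootedTreeOfGraphs P T}
    {G : SimpleGraph V} {f : V → P} (h : 𝒯.CoarseBonds) (hf : DistPreserving G 𝒯.copy f)
    (hnode : ∀ x y, 𝒯.node (f x) = 𝒯.node (f y)) {A : Set V} {m : ℕ}
    (hasdim : AsdimLT 𝒯.contraction ((fun x => 𝒯.cls (f x)) '' A) m) : AsdimLT G A m := by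
  intro r
  obtain ⟨K, hK⟩ := hasdim r
  obtain ⟨D, hD⟩ := h.exists_distLE_copy K
  refine ⟨D, hK.transfer (fun x => 𝒯.cls (f x)) (Set.mapsTo_image _ A) ?_ ?_⟩
  · exact fun x _ y _ hxy => 𝒯.distLE_cls ((hf r x y).2 hxy)
  · exact fun x _ y _ hxy => (hf D x y).1 (hD _ _ (hnode x y) hxy)

end RootedTreeOfGraphs

namespace AmalgamData

section AdhesionSets

variable {V₁ V₂ I₁ I₂ W₁ W₂ : Type*} {D : AmalgamData V₁ V₂ I₁ I₂ W₁ W₂}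
  {G₁ : SimpleGraph V₁} {G₂ : SimpleGraph V₂} {m : ℕ}

/-- The bonding maps between labels that are related by `R` are coarse equivalences, with the same
control functions. -/
def CoarseOn (D : AmalgamData V₁ V₂ I₁ I₂ W₁ W₂) (G₁ : SimpleGraph V₁) (G₂ : SimpleGraph V₂)
    (R : I₁ → I₂ → Prop) : Prop :=
  UniformlyBornologous G₁ G₂ D.φ R ∧
    UniformlyBornologous G₂ G₁ (fun l k => (D.φ k l).symm) fun l k => R k l

/-- The relation `R` contains the pairs of labels of the tree edges. -/
def LabelsIn (D : AmalgamData V₁ V₂ I₁ I₂ W₁ W₂) (R : I₁ → I₂ → Prop) : Prop :=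
  ∀ u w, D.tree.Adj (Sum.inl u) (Sum.inr w) → R (D.lab₁ u w) (D.lab₂ w u)

/-- Some adhesion set in one of the two graphs has asymptotic dimension less than `m`. -/
def AdhesionAsdimLT (D : AmalgamData V₁ V₂ I₁ I₂ W₁ W₂) (G₁ : SimpleGraph V₁)
    (G₂ : SimpleGraph V₂) (m : ℕ) : Prop :=
  (∃ k, AsdimLT G₁ (D.S₁ k) m) ∨ ∃ l, AsdimLT G₂ (D.S₂ l) m

section CoarseOn

variable {R : I₁ → I₂ → Prop}

lemma CoarseOn.asdimLT_iff (h : D.CoarseOn G₁ G₂ R) {k : I₁} {l : I₂} (hkl : R k l) :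
    AsdimLT G₁ (D.S₁ k) m ↔ AsdimLT G₂ (D.S₂ l) m :=
  ⟨h.2.asdimLT h.1 hkl, h.1.asdimLT h.2 hkl⟩

lemma CoarseOn.exists_distLE_of_bond (h : D.CoarseOn G₁ G₂ R) (hR : D.LabelsIn R) (r : ℕ) :
    ∃ K, ∀ {u x w y x' y'}, D.Bond u x w y → D.Bond u x' w y' →
      (DistLE G₁ r x x' → DistLE G₂ K y y') ∧ (DistLE G₂ r y y' → DistLE G₁ K x x') := by
  obtain ⟨K₁, hK₁⟩ := h.1 r
  obtain ⟨K₂, hK₂⟩ := h.2 r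
  refine ⟨max K₁ K₂, ?_⟩
  rintro u x w _ x' _ ⟨huw, hx, rfl⟩ ⟨-, hx', rfl⟩
  refine ⟨fun hr => ?_, fun hr => ?_⟩
  · exact (hK₁ _ _ (hR u w huw) ⟨x, hx⟩ ⟨x', hx'⟩ hr).mono (le_max_left K₁ K₂)
  · simpa using (hK₂ _ _ (hR u w huw) _ _ hr).mono (le_max_right K₁ K₂)

lemma CoarseOn.coarseBonds_rooted (h : D.CoarseOn G₁ G₂ R) (hR : D.LabelsIn R)
    (hident : D.FiniteIdentification) : (D.rooted G₁ G₂ hident).CoarseBonds := by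
  intro r
  obtain ⟨K, hK⟩ := h.exists_distLE_of_bond hR r
  refine ⟨K, ?_⟩
  rintro (⟨u, x⟩ | ⟨w, y⟩) (⟨u', x'⟩ | ⟨w', y'⟩) (⟨v, a⟩ | ⟨v, b⟩) (⟨v', a'⟩ | ⟨v', b'⟩)
    hp hq hpq hpq' hr
  all_goals first | exact hp.elim | exact hq.elim | cases hpq
  · obtain rfl : w' = v' := Sum.inr_injective hpq'
    have hxa : DistLE G₁ r x a := (D.distPreserving_inl G₁ G₂ u r x a).1 hr
    exact (D.distPreserving_inr G₁ G₂ w' K y' b').2 ((hK hp hq).1 hxa)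
  · obtain rfl : u' = v' := Sum.inl_injective hpq'
    have hyb : DistLE G₂ r y b := (D.distPreserving_inr G₁ G₂ w r y b).1 hr
    exact (D.distPreserving_inl G₁ G₂ u' K x' a').2 ((hK hp hq).2 hyb)

end CoarseOn

section Fibres

variable {hident : D.FiniteIdentification}

lemma familyAsdimLT_node (h₁ : AsdimLT G₁ Set.univ m) (h₂ : AsdimLT G₂ Set.univ m) :
    FamilyAsdimLT (D.copies G₁ G₂) (fun t => node ⁻¹' {t}) m := by
  refine .of_sum ?_ ?_
  · refine FamilyAsdimLT.of_distPreserving (E := fun _ : Unit => Set.univ) (fun r => ?_) fun u _ =>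
      ⟨(), _, D.distPreserving_inl G₁ G₂ u, ?_⟩
    · exact (h₁ r).imp fun _ hD _ => hD
    · rintro (⟨v, x⟩ | q) hp
      · obtain rfl : v = u := Sum.inl_injective hp
        exact ⟨x, Set.mem_univ x, rfl⟩
      · cases hp
  · refine FamilyAsdimLT.of_distPreserving (E := fun _ : Unit => Set.univ) (fun r => ?_) fun w _ =>
      ⟨(), _, D.distPreserving_inr G₁ G₂ w, ?_⟩
    · exact (h₂ r).imp fun _ hD _ => hD
    · rintro (q | ⟨v, x⟩) hp
      · cases hp
      · obtain rfl : v = w := Sum.inr_injective hp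
        exact ⟨x, Set.mem_univ x, rfl⟩

lemma exists_bond_of_mem_joint_inl {u : W₁} {p : (W₁ × V₁) ⊕ (W₂ × V₂)}
    (hp : p ∈ (D.rooted G₁ G₂ hident).joint (Sum.inl u)) :
    ∃ x w y, p = Sum.inl (u, x) ∧ (D.rooted G₁ G₂ hident).parent (Sum.inl u) = Sum.inr w ∧
      D.Bond u x w y := by
  obtain ⟨hnode, hup⟩ := hp
  obtain ⟨hbond, hparent, -⟩ := RootedTreeOfGraphs.up_spec hup
  rw [hnode] at hparent
  generalize (D.rooted G₁ G₂ hident).up p = q at hbond hparent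
  rcases p with ⟨v, x⟩ | p <;> rcases q with q | ⟨w, y⟩
  · exact hbond.elim
  · obtain rfl : v = u := Sum.inl_injective hnode
    exact ⟨x, w, y, rfl, hparent.symm, hbond⟩
  · cases hnode
  · exact hbond.elim

lemma exists_bond_of_mem_joint_inr {w : W₂} {p : (W₁ × V₁) ⊕ (W₂ × V₂)}
    (hp : p ∈ (D.rooted G₁ G₂ hident).joint (Sum.inr w)) :
    ∃ y u x, p = Sum.inr (w, y) ∧ (D.rooted G₁ G₂ hident).parent (Sum.inr w) = Sum.inl u ∧
      D.Bond u x w y := by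
  obtain ⟨hnode, hup⟩ := hp
  obtain ⟨hbond, hparent, -⟩ := RootedTreeOfGraphs.up_spec hup
  rw [hnode] at hparent
  generalize (D.rooted G₁ G₂ hident).up p = q at hbond hparent
  rcases p with p | ⟨v, y⟩ <;> rcases q with ⟨u, x⟩ | q
  · exact hbond.elim
  · cases hnode
  · obtain rfl : v = w := Sum.inr_injective hnode
    exact ⟨y, u, x, rfl, hparent.symm, hbond⟩
  · exact hbond.elim

lemma familyAsdimLT_joint (h₁ : FamilyAsdimLT G₁ D.S₁ m) (h₂ : FamilyAsdimLT G₂ D.S₂ m) :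
    FamilyAsdimLT (D.copies G₁ G₂) (D.rooted G₁ G₂ hident).joint m := by
  refine .of_sum (h₁.of_distPreserving ?_) (h₂.of_distPreserving ?_)
  · rintro u ⟨_, hp⟩
    obtain ⟨_, w, -, -, hparent, -⟩ := exists_bond_of_mem_joint_inl hp
    refine ⟨D.lab₁ u w, _, D.distPreserving_inl G₁ G₂ u, fun p hp => ?_⟩
    obtain ⟨x, w', y, rfl, hparent', hbond⟩ := exists_bond_of_mem_joint_inl hp
    obtain rfl : w = w' := Sum.inr_injective (hparent.symm.trans hparent')
    exact ⟨x, hbond.left_mem, rfl⟩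
  · rintro w ⟨_, hp⟩
    obtain ⟨_, u, -, -, hparent, -⟩ := exists_bond_of_mem_joint_inr hp
    refine ⟨D.lab₂ w u, _, D.distPreserving_inr G₁ G₂ w, fun p hp => ?_⟩
    obtain ⟨y, u', x, rfl, hparent', hbond⟩ := exists_bond_of_mem_joint_inr hp
    obtain rfl : u = u' := Sum.inl_injective (hparent.symm.trans hparent')
    exact ⟨y, hbond.right_mem, rfl⟩

lemma joint_eq_empty (hE : ∀ u w, ¬D.tree.Adj (Sum.inl u) (Sum.inr w)) (t : W₁ ⊕ W₂) :
    (D.rooted G₁ G₂ hident).joint t = ∅ := by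
  refine Set.eq_empty_of_forall_notMem fun p hp => ?_
  rcases t with u | w
  · obtain ⟨_, w, _, _, _, hbond⟩ := exists_bond_of_mem_joint_inl hp
    exact hE u w hbond.1
  · obtain ⟨_, u, _, _, _, hbond⟩ := exists_bond_of_mem_joint_inr hp
    exact hE u w hbond.1

end Fibres

end AdhesionSets

section Respect

variable {V₁ V₂ I₁ I₂ W₁ W₂ Γ₁ Γ₂ : Type*} [Group Γ₁] [MulAction Γ₁ V₁] [Group Γ₂]
  [MulAction Γ₂ V₂] {D : AmalgamData V₁ V₂ I₁ I₂ W₁ W₂} {G₁ : SimpleGraph V₁} {G₂ : SimpleGraph V₂}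
  {R : I₁ → I₂ → Prop} {u : W₁} {w : W₂} {m : ℕ}

lemma RespectsActions.exists_respectsAndConsistent (h : D.RespectsActions G₁ G₂ Γ₁ Γ₂) :
    ∃ R, D.RespectsAndConsistent Γ₁ Γ₂ R ∧ D.LabelsIn R := by
  rcases h with h | ⟨-, -, ι, J, -, -, hlab, h⟩
  · exact ⟨_, h, fun _ _ _ => trivial⟩
  · exact ⟨_, h, hlab⟩

lemma RespectsAndConsistent.coarseOn (h : D.RespectsAndConsistent Γ₁ Γ₂ R)
    (hfin₁ : ∀ x, (G₁.neighborSet x).Finite) (hfin₂ : ∀ x, (G₂.neighborSet x).Finite)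
    (hconn₁ : G₁.Connected) (hconn₂ : G₂.Connected)
    (hact₁ : ActsQuasiTransitively Γ₁ G₁) (hact₂ : ActsQuasiTransitively Γ₂ G₂)
    (hident : D.FiniteIdentification) (u : W₁) (w : W₂) : D.CoarseOn G₁ G₂ R := by
  obtain ⟨hresp₁, hresp₂, hcons₁, hcons₂⟩ := h
  exact ⟨uniformlyBornologous_of_respectsElement hfin₁ hconn₂ hact₁ hact₂.1
      (hident.finite_setOf_mem₁ u) hresp₁ hcons₁,
    uniformlyBornologous_of_respectsElement hfin₂ hconn₁ hact₂ hact₁.1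
      (hident.finite_setOf_mem₂ w) hresp₂ hcons₂⟩

lemma IsType1.forall_asdimLT (h : D.IsType1 Γ₁ Γ₂)
    (hcoarse : ∀ R, D.RespectsAndConsistent Γ₁ Γ₂ R → D.CoarseOn G₁ G₂ R) (u : W₁) (w : W₂)
    (hm : D.AdhesionAsdimLT G₁ G₂ m) :
    (∀ k, AsdimLT G₁ (D.S₁ k) m) ∧ ∀ l, AsdimLT G₂ (D.S₂ l) m := by
  have hiff : ∀ k l, AsdimLT G₁ (D.S₁ k) m ↔ AsdimLT G₂ (D.S₂ l) m :=
    fun _ _ => (hcoarse _ h).asdimLT_iff trivial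
  rcases hm with ⟨k, hk⟩ | ⟨l, hl⟩
  · have hall : ∀ l, AsdimLT G₂ (D.S₂ l) m := fun l => (hiff k l).1 hk
    exact ⟨fun k' => (hiff k' (D.lab₂ w u)).2 (hall _), hall⟩
  · have hall : ∀ k, AsdimLT G₁ (D.S₁ k) m := fun k => (hiff k l).2 hl
    exact ⟨hall, fun l' => (hiff (D.lab₁ u w) l').1 (hall _)⟩

lemma iff_of_forall_mem_iff_notMem {ι : Type*} {J : Set ι} {P : ι → Prop}
    (h : ∀ i j, (i ∈ J ↔ j ∉ J) → (P i ↔ P j)) {a b : ι} (hab : a ∈ J ↔ b ∉ J) (i j : ι) :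
    P i ↔ P j := by
  have key : ∀ i, P i ↔ P a := fun i => by
    by_cases hi : i ∈ J ↔ a ∉ J
    · exact h i a hi
    · exact (h i b (by tauto)).trans (h a b hab).symm
  exact (key i).trans (key j).symm

lemma IsType2.forall_asdimLT (h : D.IsType2 G₁ G₂ Γ₁ Γ₂)
    (hcoarse : ∀ R, D.RespectsAndConsistent Γ₁ Γ₂ R → D.CoarseOn G₁ G₂ R)
    (huw : D.tree.Adj (Sum.inl u) (Sum.inr w)) (hm : D.AdhesionAsdimLT G₁ G₂ m) :
    (∀ k, AsdimLT G₁ (D.S₁ k) m) ∧ ∀ l, AsdimLT G₂ (D.S₂ l) m := by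
  obtain ⟨α, -, ι, J, -, hS, hlab, hR⟩ := h
  have hι : ∀ k, AsdimLT G₁ (D.S₁ k) m ↔ AsdimLT G₂ (D.S₂ (ι k)) m := by
    refine fun k => ⟨fun hk => (DistPreserving.of_iso α.symm).asdimLT_of_mapsTo hk ?_,
      fun hk => (DistPreserving.of_iso α).asdimLT_of_mapsTo hk ?_⟩
    · rw [hS k]
      rintro _ ⟨x, hx, rfl⟩
      simpa using hx
    · rw [hS k]
      exact Set.mapsTo_image α (D.S₁ k)
  have hJ : ∀ k k', (k ∈ J ↔ k' ∉ J) → (AsdimLT G₁ (D.S₁ k) m ↔ AsdimLT G₁ (D.S₁ k') m) := by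
    intro k k' hkk'
    rw [hι k', (hcoarse _ hR).asdimLT_iff]
    rwa [ι.injective.mem_set_image]
  obtain ⟨k, hk⟩ : ∃ k, AsdimLT G₁ (D.S₁ k) m := by
    rcases hm with hm | ⟨l, hl⟩
    · exact hm
    · exact ⟨ι.symm l, (hι _).2 (by rwa [ι.apply_symm_apply])⟩
  have hedge : D.lab₁ u w ∈ J ↔ ι.symm (D.lab₂ w u) ∉ J := by
    rw [hlab u w huw, ι.image_eq_preimage_symm, Set.mem_preimage]
  have hall : ∀ k', AsdimLT G₁ (D.S₁ k') m := fun k' =>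
    (iff_of_forall_mem_iff_notMem hJ hedge k' k).2 hk
  exact ⟨hall, fun l => ι.apply_symm_apply l ▸ (hι _).1 (hall (ι.symm l))⟩

lemma RespectsActions.coarseBonds_rooted (h : D.RespectsActions G₁ G₂ Γ₁ Γ₂)
    (hfin₁ : ∀ x, (G₁.neighborSet x).Finite) (hfin₂ : ∀ x, (G₂.neighborSet x).Finite)
    (hconn₁ : G₁.Connected) (hconn₂ : G₂.Connected)
    (hact₁ : ActsQuasiTransitively Γ₁ G₁) (hact₂ : ActsQuasiTransitively Γ₂ G₂)
    (hident : D.FiniteIdentification) : (D.rooted G₁ G₂ hident).CoarseBonds := by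
  by_cases hE : ∃ u w, D.tree.Adj (Sum.inl u) (Sum.inr w)
  · obtain ⟨u, w, -⟩ := hE
    obtain ⟨R, hR, hlab⟩ := h.exists_respectsAndConsistent
    exact (hR.coarseOn hfin₁ hfin₂ hconn₁ hconn₂ hact₁ hact₂ hident u w).coarseBonds_rooted
      hlab hident
  · have hcoarse : D.CoarseOn G₁ G₂ fun _ _ => False :=
      ⟨fun _ => ⟨0, fun _ _ => False.elim⟩, fun _ => ⟨0, fun _ _ => False.elim⟩⟩
    exact hcoarse.coarseBonds_rooted (fun u w huw => hE ⟨u, w, huw⟩) hident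

lemma RespectsActions.familyAsdimLT_joint (h : D.RespectsActions G₁ G₂ Γ₁ Γ₂)
    (hfin₁ : ∀ x, (G₁.neighborSet x).Finite) (hfin₂ : ∀ x, (G₂.neighborSet x).Finite)
    (hconn₁ : G₁.Connected) (hconn₂ : G₂.Connected)
    (hact₁ : ActsQuasiTransitively Γ₁ G₁) (hact₂ : ActsQuasiTransitively Γ₂ G₂)
    (hident : D.FiniteIdentification) (hm : D.AdhesionAsdimLT G₁ G₂ m) :
    FamilyAsdimLT (D.copies G₁ G₂) (D.rooted G₁ G₂ hident).joint m := by
  by_cases hE : ∃ u w, D.tree.Adj (Sum.inl u) (Sum.inr w)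
  · obtain ⟨u, w, huw⟩ := hE
    have hcoarse : ∀ R, D.RespectsAndConsistent Γ₁ Γ₂ R → D.CoarseOn G₁ G₂ R := fun _ hR =>
      hR.coarseOn hfin₁ hfin₂ hconn₁ hconn₂ hact₁ hact₂ hident u w
    obtain ⟨h₁, h₂⟩ : (∀ k, AsdimLT G₁ (D.S₁ k) m) ∧ ∀ l, AsdimLT G₂ (D.S₂ l) m :=
      h.elim (fun h => h.forall_asdimLT hcoarse u w hm) fun h => h.forall_asdimLT hcoarse huw hm
    obtain ⟨R, ⟨hresp₁, hresp₂, -⟩, -⟩ := h.exists_respectsAndConsistent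
    exact AmalgamData.familyAsdimLT_joint
      (familyAsdimLT_of_respectsElement hact₁ (hident.finite_setOf_mem₁ u) hresp₁ h₁)
      (familyAsdimLT_of_respectsElement hact₂ (hident.finite_setOf_mem₂ w) hresp₂ h₂)
  · refine fun r => ⟨0, fun t => ?_⟩
    rw [joint_eq_empty fun u w huw => hE ⟨u, w, huw⟩]
    exact .empty _ m r 0

lemma nonempty_copies [Nonempty V₁] [Nonempty V₂] (D : AmalgamData V₁ V₂ I₁ I₂ W₁ W₂) :
    Nonempty ((W₁ × V₁) ⊕ (W₂ × V₂)) := by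
  obtain ⟨u | w⟩ := D.isTree.connected.nonempty
  · exact ⟨Sum.inl (u, Classical.arbitrary V₁)⟩
  · exact ⟨Sum.inr (w, Classical.arbitrary V₂)⟩

lemma RespectsActions.graphAsdim_amalgam_le (h : D.RespectsActions G₁ G₂ Γ₁ Γ₂)
    (hfin₁ : ∀ x, (G₁.neighborSet x).Finite) (hfin₂ : ∀ x, (G₂.neighborSet x).Finite)
    (hconn₁ : G₁.Connected) (hconn₂ : G₂.Connected)
    (hact₁ : ActsQuasiTransitively Γ₁ G₁) (hact₂ : ActsQuasiTransitively Γ₂ G₂)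
    (hident : D.FiniteIdentification) {s : ℕ∞}
    (hs : ∀ n : ℕ, s + 1 ≤ n → D.AdhesionAsdimLT G₁ G₂ n) :
    graphAsdim (D.amalgam G₁ G₂) ≤ max (max (graphAsdim G₁) (graphAsdim G₂)) (s + 1) := by
  have := hconn₁.nonempty
  have := hconn₂.nonempty
  have := D.nonempty_copies
  generalize hbound : max (max (graphAsdim G₁) (graphAsdim G₂)) (s + 1) = b
  induction b using ENat.recTopCoe with
  | top => exact le_top
  | coe n =>
    obtain ⟨⟨h₁, h₂⟩, hsn⟩ : (graphAsdim G₁ ≤ n ∧ graphAsdim G₂ ≤ n) ∧ s + 1 ≤ n := by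
      simpa only [max_le_iff] using hbound.le
    have hjoint := h.familyAsdimLT_joint hfin₁ hfin₂ hconn₁ hconn₂ hact₁ hact₂ hident (hs n hsn)
    have hnode : FamilyAsdimLT (D.copies G₁ G₂) (fun t => node ⁻¹' {t}) (n + 1) :=
      familyAsdimLT_node (asdimLT_univ_of_graphAsdim_le h₁) (asdimLT_univ_of_graphAsdim_le h₂)
    let := graphMetric (D.amalgam G₁ G₂)
    exact asdim_le_natCast_iff.2
      ((h.coarseBonds_rooted hfin₁ hfin₂ hconn₁ hconn₂ hact₁ hact₂ hident).asdimLE_contraction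
        hnode hjoint)

end Respect

end AmalgamData

theorem theorem1 {V₁ V₂ I₁ I₂ W₁ W₂ Γ₁ Γ₂ : Type*}
    [Group Γ₁] [MulAction Γ₁ V₁] [Group Γ₂] [MulAction Γ₂ V₂]
    (G₁ : SimpleGraph V₁) (G₂ : SimpleGraph V₂)
    (hfin₁ : ∀ x, (G₁.neighborSet x).Finite) (hfin₂ : ∀ x, (G₂.neighborSet x).Finite)
    (hconn₁ : G₁.Connected) (hconn₂ : G₂.Connected)
    (hact₁ : ActsQuasiTransitively Γ₁ G₁) (hact₂ : ActsQuasiTransitively Γ₂ G₂)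
    (D : AmalgamData V₁ V₂ I₁ I₂ W₁ W₂)
    (hident : D.FiniteIdentification)
    (hresp : D.RespectsActions G₁ G₂ Γ₁ Γ₂) :
    (∀ k : I₁, graphAsdim (D.amalgam G₁ G₂) ≤
      max (max (graphAsdim G₁) (graphAsdim G₂)) (setAsdim G₁ (D.S₁ k) + 1)) ∧
    (∀ l : I₂, graphAsdim (D.amalgam G₁ G₂) ≤
      max (max (graphAsdim G₁) (graphAsdim G₂)) (setAsdim G₂ (D.S₂ l) + 1)) ∧
    (∀ (u : W₁) (k : I₁), graphAsdim (D.amalgam G₁ G₂) ≤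
      max (max (graphAsdim G₁) (graphAsdim G₂))
        (setAsdim (D.amalgam G₁ G₂) (D.image₁ u k) + 1)) ∧
    (∀ (w : W₂) (l : I₂), graphAsdim (D.amalgam G₁ G₂) ≤
      max (max (graphAsdim G₁) (graphAsdim G₂))
        (setAsdim (D.amalgam G₁ G₂) (D.image₂ w l) + 1)) := by
  have hcoarse := hresp.coarseBonds_rooted hfin₁ hfin₂ hconn₁ hconn₂ hact₁ hact₂ hident
  have hle : ∀ s : ℕ∞, (∀ n : ℕ, s + 1 ≤ n → D.AdhesionAsdimLT G₁ G₂ n) →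
      graphAsdim (D.amalgam G₁ G₂) ≤ max (max (graphAsdim G₁) (graphAsdim G₂)) (s + 1) :=
    fun _ => hresp.graphAsdim_amalgam_le hfin₁ hfin₂ hconn₁ hconn₂ hact₁ hact₂ hident
  refine ⟨fun k => hle _ fun n hn => ?_, fun l => hle _ fun n hn => ?_,
    fun u k => hle _ fun n hn => ?_, fun w l => hle _ fun n hn => ?_⟩
  · exact .inl ⟨k, asdimLT_of_setAsdim_add_one_le hn⟩
  · exact .inr ⟨l, asdimLT_of_setAsdim_add_one_le hn⟩
  · exact .inl ⟨k, hcoarse.asdimLT_of_image (D.distPreserving_inl G₁ G₂ u) (fun _ _ => rfl)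
      (asdimLT_of_setAsdim_add_one_le hn)⟩
  · exact .inr ⟨l, hcoarse.asdimLT_of_image (D.distPreserving_inr G₁ G₂ w) (fun _ _ => rfl)
      (asdimLT_of_setAsdim_add_one_le hn)⟩
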